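/- Let $m\le 1$ be an integer and let $S=\{k\in\mathbb Z: m\le k\le -1\}\cup\{1\}$. An $S$-embedded Cayley tree of size $n$ is a tree with vertex set $\{1,\dots,n\}$, with a distinguished vertex called the root, in which every vertex $v$ carries an abscissa $a(v)\in\mathbb Z$ such that the root has abscissa $0$ and $a(v')-a(v)\in S$ whenever $v'$ is a child of $v$. The in-type of a vertex $v$ is $(i;\mathbf c)$, where $i=a(v)$ and $\mathbf c=(c^m,\dots,c^1)\in\mathbb N^{2-m}$, $c^k$ being the number of children of $v$ at abscissa $i+k$. If moreover $v$ is not the root and its parent has abscissa $i-s$, then the out-type of $v$ is $(i;s)$ and its complete type is $(i;s;\mathbf c)$. Let $\mathbf c_0=(0,\dots,0,c_0^1)\in\mathbb N^{2-m}$, and let $n(i,s,\mathbf c)$, for $i\in\mathbb Z$, $s\in S$ and $\mathbf c\in\mathbb N^{2-m}$, be non-negative integers, finitely many and at least one of which are nonzero, such that $n(i,s,\mathbf c)=0$ if $i<0$, or if $m\le 0$ and $c^0>0$. Assume that for all $i\in\mathbb Z$ and $s\in S$, $$\chi_{i=s}\,c_0^s+\sum_{t\in S,\,\mathbf c}c^s\,n(i-s,t,\mathbf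 c)=\sum_{\mathbf c}n(i,s,\mathbf c).$$ Set $$n=1+\sum_{i,s,\mathbf c}n(i,s,\mathbf c),\qquad n_i=\chi_{i=0}+\sum_{s,\mathbf c}n(i,s,\mathbf c),\qquad r=\max\{i:n_i>0\},\qquad n(i,s)=\sum_{\mathbf c}n(i,s,\mathbf c),$$ $$n_s(b)=\sum_{i,t}\ \sum_{\mathbf c:\,c^s=b}n(i,t,\mathbf c)+\chi_{s=1,\,b=c_0^1},\qquad n_1(i,1,b)=\sum_{\mathbf c:\,c^1=b}n(i,1,\mathbf c).$$ If $n(i,1)>0$ for all $1\le i\le r$, then the number of $S$-embedded Cayley trees (of size $n$) in which the root has in-type $(0;\mathbf c_0)$ and, for all $i\in\mathbb Z$, $s\in S$ and $\mathbf c\in\mathbb N^{2-m}$, exactly $n(i,s,\mathbf c)$ non-root vertices have complete type $(i;s;\mathbf c)$, is $$\frac{c_0^1\;n!\;\prod_{i\in\mathbb Z,\,s\in S}n(i,s)!}{\prod_{i,s,\mathbf c}n(i,s,\mathbf c)!\;\prod_{i=1}^{r}n(i,1)\;\prod_{b\ge 0,\,s\in S}b!^{\,n_s(b)}}\;\prod_{i=1}^{r-1}\Big(\sum_{b>0}b\,n_1(i,1,b)\Big).$$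 If $n(i,1)=0$ for some $1\le i\le r$, there is no such tree. -/

import Mathlib

open scoped Nat

/-- A rooted Cayley tree of size `N`: a tree on `N` labelled vertices with a distinguished
vertex, the root. The label set `{1, …, N}` is represented by `Fin N`. -/
structure RootedCayleyTree (N : ℕ) where
  graph : SimpleGraph (Fin N)
  isTree : graph.IsTree
  root : Fin N

/-- `w` is the parent of `v` (equivalently, `v` is a child of `w`): the two vertices are
adjacent, and `v` is one step further from the root than `w`. -/
def RootedCayleyTree.IsParent {N : ℕ} (T : RootedCayleyTree N) (w v : Fin N) : Prop :=
  T.graph.Adj w v ∧ T.graph.dist T.root v = T.graph.dist T.root w + 1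

/-- An `S`-embedded Cayley tree of size `N`: a rooted Cayley tree with an abscissa at each
vertex, the root being at abscissa `0` and each parent-to-child increment lying in `S`. -/
structure EmbeddedCayleyTree (S : Finset ℤ) (N : ℕ) extends RootedCayleyTree N where
  abscissa : Fin N → ℤ
  abscissa_root : abscissa root = 0
  step_mem : ∀ w v : Fin N, toRootedCayleyTree.IsParent w v → abscissa v - abscissa w ∈ S

/-- The vectors `c = (c^m, …, c^1)` of natural numbers, indexed by the integers `m ≤ k ≤ 1`. -/
abbrev ChildVector (m : ℤ) : Type := ↥(Finset.Icc m 1) → ℕ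

/-- The component `c^k` of `c = (c^m, …, c^1)` (and `0` for `k` outside `{m, …, 1}`). -/
noncomputable def ChildVector.coord {m : ℤ} (c : ChildVector m) (k : ℤ) : ℕ :=
  if h : k ∈ Finset.Icc m 1 then c ⟨k, h⟩ else 0

/-- The vector `(0, …, 0, b)`. -/
noncomputable def rootVector (m : ℤ) (b : ℕ) : ChildVector m := fun k => if (k : ℤ) = 1 then b else 0

namespace EmbeddedCayleyTree

variable {S : Finset ℤ} {N : ℕ}

/-- The vector `(c^m, …, c^1)` of a vertex `v`: its `k`-th component is the number of children
of `v` at abscissa `a(v) + k`. -/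
noncomputable def childVector (T : EmbeddedCayleyTree S N) (m : ℤ) (v : Fin N) :
    ChildVector m :=
  fun k => {w : Fin N | T.IsParent v w ∧ T.abscissa w = T.abscissa v + (k : ℤ)}.ncard

/-- The non-root vertex `v` has complete type `(i; s; c)`: it lies at abscissa `i`, its parent
lies at abscissa `i - s`, and its children are counted by `c`. -/
def HasType (T : EmbeddedCayleyTree S N) {m : ℤ} (v : Fin N) (i s : ℤ) (c : ChildVector m) :
    Prop :=
  v ≠ T.root ∧ T.abscissa v = i ∧ (∃ w, T.IsParent w v ∧ T.abscissa w = i - s) ∧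
    T.childVector m v = c

end EmbeddedCayleyTree

/-- The set of increments `⟦m, -1⟧ ∪ {1}`. -/
noncomputable def stepSet (m : ℤ) : Finset ℤ := insert 1 (Finset.Icc m (-1))

/-- A family `n(i, s, c)` of natural numbers, for `i ∈ ℤ`, `s ∈ ⟦m, -1⟧ ∪ {1}` and
`c ∈ ℕ^(2-m)`, with finitely many nonzero terms. -/
abbrev TypeDistribution (m : ℤ) : Type := (ℤ × ↥(stepSet m) × ChildVector m) →₀ ℕ

namespace TypeDistribution

variable {m : ℤ}

/-- `n = 1 + ∑_{i,s,c} n(i,s,c)`, the number of vertices (including the root). -/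
noncomputable def size (n : TypeDistribution m) : ℕ := 1 + n.sum fun _ k => k

/-- `n(i,s) = ∑_c n(i,s,c)`, the number of vertices of out-type `(i; s)`. -/
noncomputable def outCount (n : TypeDistribution m) (i s : ℤ) : ℕ :=
  n.sum fun x k => if x.1 = i ∧ (x.2.1 : ℤ) = s then k else 0

/-- `n_i = χ_{i=0} + ∑_{s,c} n(i,s,c)`, the number of vertices at abscissa `i` (including the
root). -/
noncomputable def levelCount (n : TypeDistribution m) (i : ℤ) : ℕ :=
  (if i = 0 then 1 else 0) + n.sum fun x k => if x.1 = i then k else 0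

/-- `n_s(b) = ∑_{i,t} ∑_{c : c^s = b} n(i,t,c) + χ_{s=1, b=c₀}`, where `c₀` is the number of
children of the root. -/
noncomputable def childCount (n : TypeDistribution m) (c₀ : ℕ) (s : ℤ) (b : ℕ) : ℕ :=
  (n.sum fun x k => if x.2.2.coord s = b then k else 0) + if s = 1 ∧ b = c₀ then 1 else 0

/-- `n_1(i,1,b) = ∑_{c : c^1 = b} n(i,1,c)`, the number of vertices of out-type `(i; 1)` that
have exactly `b` children at abscissa `i + 1`. -/
noncomputable def upCount (n : TypeDistribution m) (i : ℤ) (b : ℕ) : ℕ :=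
  n.sum fun x k => if x.1 = i ∧ (x.2.1 : ℤ) = 1 ∧ x.2.2.coord 1 = b then k else 0

/-- The compatibility condition, the root having in-type `(0; 0, …, 0, c₀)`:
`χ_{i=s} c_0^s + ∑_{t,c} c^s n(i-s,t,c) = ∑_c n(i,s,c)` for all `i ∈ ℤ` and `s ∈ S`. -/
def Compatible (n : TypeDistribution m) (c₀ : ℕ) : Prop :=
  ∀ i : ℤ, ∀ s ∈ stepSet m,
    (if i = s then (rootVector m c₀).coord s else 0) +
      (n.sum fun x k => if x.1 = i - s then x.2.2.coord s * k else 0) = n.outCount i s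

/-- The number of `S`-embedded Cayley trees, `S = ⟦m, -1⟧ ∪ {1}`, whose root has in-type
`(0; 0, …, 0, c₀)` and which have exactly `n(i,s,c)` non-root vertices of complete type
`(i; s; c)`, for all `i`, `s` and `c`. (The size of such a tree is necessarily `n.size`.) -/
noncomputable def numTrees (n : TypeDistribution m) (c₀ : ℕ) : ℕ :=
  Nat.card {T : EmbeddedCayleyTree (stepSet m) n.size //
    T.childVector m T.root = rootVector m c₀ ∧
    ∀ (i : ℤ) (s : ↥(stepSet m)) (c : ChildVector m),
      {v | T.HasType v i s c}.ncard = n (i, s, c)}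

end TypeDistribution

/-! ### Functional graphs -/

/-! A tree with the prescribed statistics is a pair `(τ, p)`: an assignment `τ` of complete types to
the labels (`none` for the root) and a parent function `p` that fixes the root, respects `τ` and is
rooted, meaning that its iterates send every vertex to the root. If rootedness is dropped, the count
is elementary. There are `n! / ∏ n(i,s,c)!` assignments, and each admits `∏ n(i,s)! / ∏ b!^{n_s(b)}`
parent functions. Both are instances of `card_prescribed_fibres`, where the compatibility condition
says exactly that the prescribed fibre sizes add up.

It remains to find the proportion of rooted functions. Parent functions of a given `τ` are stable
under exchanging the images of two vertices of the same out-type. For such a pair `u, v`, the two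
functions obtained by exchange contain as many rooted ones as they do after `v` has been merged into
`u` (`isRootedAt_swap_merge`). Iterating, rootedness can be tested after each out-type class has
been collapsed to one representative (`card_isRootedAt_rep`).

The collapsed function is easy to analyse, since `1` is the only positive increment: going to the
parent lowers the abscissa by at most one. Hence a path to the root from abscissa at least `i ≥ 1`
meets the class `(i;1)`, and rootedness means that the representative of `(i;1)` has its parent in
the class `(i-1;1)`, or at the root if `i = 1` (`isRootedAt_rep_iff`).

Finally the representatives of the classes `(i;1)` are averaged over all choices. For every parent
function the number of good choices is `c₀ ∏_{i<r} ∑_b b n₁(i,1,b)`, out of `∏ n(i,1)` choices, so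
this ratio is the proportion sought (`card_rooted_mul_prod`). -/

section FunctionalGraph

variable {V : Type*}

/-- `y` is an iterated image of `x` under `h`. -/
def IterReach (h : V → V) (x y : V) : Prop := ∃ k : ℕ, h^[k] x = y

/-- Every point is eventually mapped to `ρ` by iterating `h`. -/
def IsRootedAt (h : V → V) (ρ : V) : Prop := ∀ x, IterReach h x ρ

namespace IterReach

variable {h : V → V} {x y z ρ : V}

theorem refl (h : V → V) (x : V) : IterReach h x x := ⟨0, rfl⟩

theorem head (hxy : IterReach h (h x) y) : IterReach h x y := by
  obtain ⟨k, hk⟩ := hxy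
  exact ⟨k + 1, hk⟩

theorem trans (hxy : IterReach h x y) (hyz : IterReach h y z) : IterReach h x z := by
  obtain ⟨k, rfl⟩ := hxy
  obtain ⟨l, rfl⟩ := hyz
  exact ⟨l + k, Function.iterate_add_apply h l k x⟩

theorem of_fixed_left (hx : h x = x) (hxy : IterReach h x y) : x = y := by
  obtain ⟨k, rfl⟩ := hxy
  exact (Function.iterate_fixed hx k).symm

/-- A periodic point other than the fixed point `ρ` never reaches `ρ`. -/
theorem not_root_of_cycle (hρ : h ρ = ρ) (hx : x ≠ ρ) (hc : IterReach h (h x) x) :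
    ¬ IterReach h x ρ := by
  rintro ⟨j, hj⟩
  obtain ⟨k, hk⟩ := hc
  have hper : h^[k + 1] x = x := hk
  have h1 : (h^[k + 1])^[j] x = x := Function.iterate_fixed hper j
  rw [← Function.iterate_mul] at h1
  -- After `j` full periods the point is back at `x`, yet it met the fixed point `ρ` at time `j` and
  -- has stayed there since.
  have h2 : h^[(k + 1) * j] x = ρ := by
    rw [show (k + 1) * j = k * j + j by ring, Function.iterate_add_apply, hj]
    exact Function.iterate_fixed hρ _
  exact hx (h1.symm.trans h2)

end IterReach

/-! ### Cutting a functional graph at two points and merging them -/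

section Merge

variable {h g : V → V} {ρ u v α β : V}

/-- `g` stops at `u` and `v` and agrees with `h` elsewhere. -/
structure StopsAt (g h : V → V) (u v : V) : Prop where
  left : g u = u
  right : g v = v
  off : ∀ x, x ≠ u → x ≠ v → g x = h x

theorem StopsAt.reach (hg : StopsAt g h u v) {x z : V} (hx : IterReach g x z) :
    IterReach h x z := by
  obtain ⟨k, hk⟩ := hx
  induction k generalizing x with
  | zero => exact ⟨0, hk⟩
  | succ k ih =>
    by_cases hu : x = u
    · subst hu; rw [Function.iterate_fixed hg.left] at hk; exact ⟨0, hk⟩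
    by_cases hv : x = v
    · subst hv; rw [Function.iterate_fixed hg.right] at hk; exact ⟨0, hk⟩
    refine IterReach.head (ih ?_)
    rw [← hg.off x hu hv]; exact hk

theorem StopsAt.ends (hg : StopsAt g h u v) {x : V} (hx : IterReach h x ρ) :
    IterReach g x ρ ∨ IterReach g x u ∨ IterReach g x v := by
  obtain ⟨k, hk⟩ := hx
  induction k generalizing x with
  | zero => exact Or.inl ⟨0, hk⟩
  | succ k ih =>
    by_cases hu : x = u
    · exact Or.inr (Or.inl ⟨0, hu⟩)
    by_cases hv : x = v
    · exact Or.inr (Or.inr ⟨0, hv⟩)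
    have h1 : h^[k] (g x) = ρ := by rw [hg.off x hu hv]; exact hk
    exact (ih h1).imp IterReach.head (Or.imp IterReach.head IterReach.head)

/-- All paths of `g` end at `ρ`, `u` or `v`. -/
def EndsAt (g : V → V) (ρ u v : V) : Prop :=
  ∀ x, IterReach g x ρ ∨ IterReach g x u ∨ IterReach g x v

/-- Cutting at `u` and `v` leaves only the ends `α`, `β` of the two outgoing paths to consider.
Rootedness fails exactly when they close a cycle: `α = u`, `β = v`, or `α = v` together with `β =
u`. -/
theorem StopsAt.isRootedAt_iff (hg : StopsAt g h u v) (hρ : h ρ = ρ) (hu : u ≠ ρ) (hv : v ≠ ρ)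
    (huv : u ≠ v) (hC : EndsAt g ρ u v) (hα : IterReach g (h u) α) (hβ : IterReach g (h v) β)
    (hα' : α = ρ ∨ α = u ∨ α = v) (hβ' : β = ρ ∨ β = u ∨ β = v) :
    IsRootedAt h ρ ↔ (α = ρ ∧ (β = ρ ∨ β = u)) ∨ (α = v ∧ β = ρ) := by
  have hα₁ : IterReach h (h u) α := hg.reach hα
  have hβ₁ : IterReach h (h v) β := hg.reach hβ
  have key : IsRootedAt h ρ ↔ IterReach h u ρ ∧ IterReach h v ρ := by
    refine ⟨fun H => ⟨H u, H v⟩, fun H x => ?_⟩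
    rcases hC x with h1 | h1 | h1
    · exact hg.reach h1
    · exact (hg.reach h1).trans H.1
    · exact (hg.reach h1).trans H.2
  rw [key]
  constructor
  · rintro ⟨H1, H2⟩
    have c1 : α ≠ u := by
      rintro rfl
      exact IterReach.not_root_of_cycle hρ hu hα₁ H1
    have c2 : β ≠ v := by
      rintro rfl
      exact IterReach.not_root_of_cycle hρ hv hβ₁ H2
    have c3 : ¬ (α = v ∧ β = u) := by
      rintro ⟨rfl, rfl⟩
      exact IterReach.not_root_of_cycle hρ hu (hα₁.trans hβ₁.head) H1
    tauto
  · rintro (⟨rfl, rfl | rfl⟩ | ⟨rfl, rfl⟩)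
    · exact ⟨hα₁.head, hβ₁.head⟩
    · exact ⟨hα₁.head, hβ₁.head.trans hα₁.head⟩
    · exact ⟨hα₁.head.trans hβ₁.head, hβ₁.head⟩

variable [DecidableEq V]

/-- The map replacing `v` by `u`. -/
def mergeMap (u v : V) (x : V) : V := if x = v then u else x

theorem mergeMap_of_ne {u v x : V} (hx : x ≠ v) : mergeMap u v x = x := if_neg hx

@[simp] theorem mergeMap_self (u v : V) : mergeMap u v v = u := if_pos rfl

theorem StopsAt.reach_merge (hg : StopsAt g h u v) (huv : u ≠ v) {x z : V}
    (hx : IterReach g x z) :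
    IterReach (mergeMap u v ∘ h) (mergeMap u v x) (mergeMap u v z) := by
  obtain ⟨k, hk⟩ := hx
  induction k generalizing x with
  | zero => rw [← hk]; exact ⟨0, rfl⟩
  | succ k ih =>
    by_cases hu : x = u
    · subst hu; rw [Function.iterate_fixed hg.left] at hk; rw [← hk]; exact ⟨0, rfl⟩
    by_cases hv : x = v
    · subst hv; rw [Function.iterate_fixed hg.right] at hk; rw [← hk]; exact ⟨0, rfl⟩
    rw [mergeMap_of_ne hv]
    refine IterReach.head ?_
    rw [Function.comp_apply, ← hg.off x hu hv]
    exact ih hk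

theorem StopsAt.ends_merge (hg : StopsAt g h u v) {x : V}
    (hx : IterReach (mergeMap u v ∘ h) x ρ) :
    IterReach g x ρ ∨ IterReach g x u ∨ IterReach g x v := by
  obtain ⟨k, hk⟩ := hx
  induction k generalizing x with
  | zero => exact Or.inl ⟨0, hk⟩
  | succ k ih =>
    by_cases hu : x = u
    · exact Or.inr (Or.inl ⟨0, hu⟩)
    by_cases hv : x = v
    · exact Or.inr (Or.inr ⟨0, hv⟩)
    have h1 : (mergeMap u v ∘ h)^[k] (mergeMap u v (g x)) = ρ := by
      rw [hg.off x hu hv]; exact hk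
    by_cases h2 : g x = v
    · exact Or.inr (Or.inr (IterReach.head ⟨0, h2⟩))
    rw [mergeMap_of_ne h2] at h1
    exact (ih h1).imp IterReach.head (Or.imp IterReach.head IterReach.head)

/-- After merging, nothing maps to `v`, so only the path leaving `u` can close up. It does so as
soon as it ends at `u` or at `v`, and `β` plays no role. -/
theorem StopsAt.isRootedAt_merge_iff (hg : StopsAt g h u v) (hρ : h ρ = ρ) (hu : u ≠ ρ)
    (hv : v ≠ ρ) (huv : u ≠ v) (hC : EndsAt g ρ u v) (hα : IterReach g (h u) α)
    (hβ : IterReach g (h v) β)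
    (hα' : α = ρ ∨ α = u ∨ α = v) (hβ' : β = ρ ∨ β = u ∨ β = v) :
    IsRootedAt (mergeMap u v ∘ h) ρ ↔ α = ρ := by
  have hρ₁ : (mergeMap u v ∘ h) ρ = ρ := by
    rw [Function.comp_apply, hρ, mergeMap_of_ne hv.symm]
  have hα₁ := hg.reach_merge huv hα
  have hβ₁ := hg.reach_merge huv hβ
  constructor
  · intro H
    rcases hα' with rfl | hα' | hα'
    · rfl
    all_goals
      refine absurd (H u) (IterReach.not_root_of_cycle hρ₁ hu ?_)
      rw [hα'] at hα₁
      simpa [mergeMap_of_ne huv] using hα₁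
  · rintro rfl
    rw [mergeMap_of_ne hv.symm] at hα₁
    have Hu : IterReach (mergeMap u v ∘ h) u α := hα₁.head
    have aux : ∀ z, z = α ∨ z = u ∨ z = v → IterReach (mergeMap u v ∘ h) (mergeMap u v z) α := by
      rintro z (rfl | rfl | rfl)
      · rw [mergeMap_of_ne hv.symm]; exact IterReach.refl _ _
      · rwa [mergeMap_of_ne huv]
      · rwa [mergeMap_self]
    intro x
    by_cases hx : x = v
    · subst hx
      exact IterReach.head (hβ₁.trans (aux β hβ'))
    · rw [← mergeMap_of_ne (u := u) hx]
      rcases hC x with h1 | h1 | h1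
      · exact (hg.reach_merge huv h1).trans (aux _ (by simp))
      · exact (hg.reach_merge huv h1).trans (aux _ (by simp))
      · exact (hg.reach_merge huv h1).trans (aux _ (by simp))

open Classical in
/-- Exchanging the images of `u` and `v` and merging `v` into `u`: among the two functions
obtained by exchange, as many are rooted before as after merging. -/
theorem isRootedAt_swap_merge (hρ : h ρ = ρ) (hu : u ≠ ρ) (hv : v ≠ ρ) (huv : u ≠ v) :
    (if IsRootedAt h ρ then 1 else 0) +
      (if IsRootedAt (h ∘ Equiv.swap u v) ρ then 1 else 0) =
    (if IsRootedAt (mergeMap u v ∘ h) ρ then 1 else 0) +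
      (if IsRootedAt (mergeMap u v ∘ h ∘ Equiv.swap u v) ρ then 1 else 0 : ℕ) := by
  set h' := h ∘ Equiv.swap u v with hh'
  set g : V → V := fun x => if x = u ∨ x = v then x else h x with hgdef
  have hg : StopsAt g h u v :=
    ⟨by simp [hgdef], by simp [hgdef], fun x h1 h2 => by simp [hgdef, h1, h2]⟩
  have hg' : StopsAt g h' u v :=
    ⟨by simp [hgdef], by simp [hgdef],
      fun x h1 h2 => by simp [hgdef, hh', h1, h2, Equiv.swap_apply_of_ne_of_ne h1 h2]⟩
  have hρ' : h' ρ = ρ := by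
    simp [hh', Equiv.swap_apply_of_ne_of_ne hu.symm hv.symm, hρ]
  by_cases hC : EndsAt g ρ u v
  · have hend : ∀ x, ∃ α, IterReach g x α ∧ (α = ρ ∨ α = u ∨ α = v) := by
      intro x
      rcases hC x with h1 | h1 | h1
      · exact ⟨ρ, h1, by simp⟩
      · exact ⟨u, h1, by simp⟩
      · exact ⟨v, h1, by simp⟩
    obtain ⟨α, hα, hα'⟩ := hend (h u)
    obtain ⟨β, hβ, hβ'⟩ := hend (h v)
    have h'u : h' u = h v := by simp [hh']
    have h'v : h' v = h u := by simp [hh']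
    rw [if_congr (hg.isRootedAt_iff hρ hu hv huv hC hα hβ hα' hβ') rfl rfl,
      if_congr (hg'.isRootedAt_iff hρ' hu hv huv hC (h'u ▸ hβ) (h'v ▸ hα) hβ' hα') rfl rfl,
      if_congr (hg.isRootedAt_merge_iff hρ hu hv huv hC hα hβ hα' hβ') rfl rfl,
      if_congr (hg'.isRootedAt_merge_iff hρ' hu hv huv hC (h'u ▸ hβ) (h'v ▸ hα) hβ' hα') rfl rfl]
    -- The exchange swaps `α` and `β`. In each of the nine cases both sides equal `[α = ρ] + [β =
    -- ρ]`.
    rcases hα' with rfl | rfl | rfl <;> rcases hβ' with rfl | rfl | rfl <;>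
      simp [huv, hu, hv, huv.symm, hu.symm, hv.symm]
  -- If some path of the cut map never ends at `ρ`, `u` or `v`, none of the four maps is rooted.
  · rw [if_neg fun H => hC fun x => hg.ends (H x), if_neg fun H => hC fun x => hg'.ends (H x),
      if_neg fun H => hC fun x => hg.ends_merge (H x),
      if_neg fun H => hC fun x => hg'.ends_merge (H x)]

end Merge

end FunctionalGraph

/-! ### Counting rooted maps by successive merging -/

section MergeCount

open Classical in
/-- Counting rooted functions in a family stable under exchanging the images of `u` and `v`. -/
theorem card_isRootedAt_merge {V : Type*} (F : Finset (V → V)) {ρ u v : V} (q : V → V)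
    (hF : ∀ f ∈ F, f ∘ Equiv.swap u v ∈ F) (hρ : ∀ f ∈ F, q (f ρ) = ρ)
    (hu : u ≠ ρ) (hv : v ≠ ρ) (huv : u ≠ v) :
    (F.filter fun f => IsRootedAt (q ∘ f) ρ).card =
      (F.filter fun f => IsRootedAt (mergeMap u v ∘ q ∘ f) ρ).card := by
  -- Exchange is an involution of `F`, so the two terms on each side of the identity have equal sums
  -- over `F`, and the factor `2` cancels.
  have hinv : ∀ A : (V → V) → ℕ, ∑ f ∈ F, A (f ∘ Equiv.swap u v) = ∑ f ∈ F, A f := fun A =>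
    Finset.sum_bij' (fun f _ => f ∘ Equiv.swap u v) (fun f _ => f ∘ Equiv.swap u v)
      hF hF (fun f _ => by ext x; simp) (fun f _ => by ext x; simp) (fun f _ => rfl)
  have key := Finset.sum_congr rfl fun f hf =>
    isRootedAt_swap_merge (h := q ∘ f) (ρ := ρ) (hρ f hf) hu hv huv
  rw [Finset.sum_add_distrib, Finset.sum_add_distrib] at key
  have e1 := hinv fun f => if IsRootedAt (q ∘ f) ρ then 1 else 0
  have e2 := hinv fun f => if IsRootedAt (mergeMap u v ∘ q ∘ f) ρ then 1 else 0
  simp only [Function.comp_assoc] at key e1 e2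
  rw [e1, e2] at key
  rw [Finset.card_filter, Finset.card_filter]
  omega

open Classical in
/-- In a family of functions stable under exchanging the images of vertices of the same colour,
as many are rooted as become rooted when all vertices of each colour are merged into a
representative. -/
theorem card_isRootedAt_rep {V K : Type*} [Fintype V] (κ : V → K) (rep : K → V)
    (hrep : ∀ v, κ (rep (κ v)) = κ v) (ρ : V) (hκ : ∀ v, κ v = κ ρ → v = ρ)
    (F : Finset (V → V)) (hρ : ∀ f ∈ F, f ρ = ρ)
    (hF : ∀ f ∈ F, ∀ u v, κ u = κ v → f ∘ Equiv.swap u v ∈ F) :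
    (F.filter fun f => IsRootedAt f ρ).card =
      (F.filter fun f => IsRootedAt (fun x => rep (κ (f x))) ρ).card := by
  have hrepρ : rep (κ ρ) = ρ := hκ _ (hrep ρ)
  -- `A` is the set of vertices already merged into their representatives. The root is alone in its
  -- colour, so it is never involved in a merger.
  have key : ∀ A : Finset V, (∀ v ∈ A, v ≠ rep (κ v)) →
      (F.filter fun f => IsRootedAt f ρ).card =
      (F.filter fun f => IsRootedAt ((fun x => if x ∈ A then rep (κ x) else x) ∘ f) ρ).card := by
    intro A
    induction A using Finset.induction_on with
    | empty => intro _; simp [Function.comp_def]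
    | insert v A hvA ih =>
      intro hA
      have hv : v ≠ rep (κ v) := hA v (Finset.mem_insert_self v A)
      have hA' : ∀ w ∈ A, w ≠ rep (κ w) := fun w hw => hA w (Finset.mem_insert_of_mem hw)
      have hvρ : v ≠ ρ := by rintro rfl; exact hv hrepρ.symm
      have huρ : rep (κ v) ≠ ρ := by
        intro h; exact hvρ (hκ v (by rw [← hrep v, h]))
      have hrr : ∀ w, rep (κ (rep (κ w))) = rep (κ w) := fun w => by rw [hrep]
      rw [ih hA', card_isRootedAt_merge F _ (fun f hf => hF f hf _ _ (hrep v)) ?_ huρ hvρ hv.symm]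
      · congr 1
        refine Finset.filter_congr fun f _ => ?_
        rw [← Function.comp_assoc]
        suffices h : (mergeMap (rep (κ v)) v ∘ fun x => if x ∈ A then rep (κ x) else x) =
            fun x => if x ∈ insert v A then rep (κ x) else x by rw [h]
        funext x
        by_cases hxv : x = v
        · subst hxv; simp [hvA]
        by_cases hxA : x ∈ A
        · simp only [Function.comp_apply, hxA, if_true, Finset.mem_insert, or_true]
          -- Merged vertices are never representatives, so the new merger does not move the images
          -- of the earlier ones.
          refine mergeMap_of_ne ?_
          intro h
          exact hv (by rw [← h, hrr])
        · simp [hxA, hxv, mergeMap_of_ne]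
      · intro f hf
        rw [hρ f hf, if_neg]
        intro h
        exact hA' ρ h hrepρ.symm
  have h := key (Finset.univ.filter fun v => v ≠ rep (κ v)) (by simp)
  rw [h]
  congr 1
  refine Finset.filter_congr fun f _ => ?_
  suffices h : ((fun x => if x ∈ Finset.univ.filter (fun v => v ≠ rep (κ v)) then rep (κ x) else x)
      ∘ f) = fun x => rep (κ (f x)) by rw [h]
  funext x
  by_cases hx : f x = rep (κ (f x))
  · simp [← hx]
  · simp [hx]

end MergeCount

/-! ### Functions with prescribed fibre sizes and colours -/

section FibreCount

/-- The number of permutations `g` with `f₀ ∘ g = f` is independent of `f` (for functions `f`,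
`f₀` whose fibres have the same sizes). -/
theorem card_perm_comp_eq {α β : Type*} [Fintype α] [DecidableEq α] (f₀ f : α → β)
    (h : ∀ b, Nat.card {a // f a = b} = Nat.card {a // f₀ a = b}) :
    Nat.card {g : Equiv.Perm α // f₀ ∘ g = f} = Nat.card {g : Equiv.Perm α // f₀ ∘ g = f₀} := by
  have e : ∀ b, Nonempty ({a // f a = b} ≃ {a // f₀ a = b}) := fun b =>
    Finite.card_eq.mp (h b)
  replace e := fun b => (e b).some
  -- One solution of `f₀ ∘ g₁ = f` suffices: all solutions form a coset of the stabilizer of `f₀`.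
  set g₁ : Equiv.Perm α := Equiv.ofFiberEquiv e with hg₁
  have hg : f₀ ∘ g₁ = f := by funext a; exact Equiv.ofFiberEquiv_map e a
  refine Nat.card_congr ((Equiv.mulRight g₁⁻¹).subtypeEquiv fun g => ?_)
  simp only [Equiv.coe_mulRight, Equiv.Perm.coe_mul]
  constructor
  · intro H
    rw [← Function.comp_assoc, H, ← hg]; funext a; simp
  · intro H
    rw [← hg]; nth_rewrite 2 [← H]; funext a; simp

theorem card_perm_comp_self {α β : Type*} [Fintype α] [DecidableEq α] [DecidableEq β]
    (f : α → β) (B : Finset β) (hB : ∀ a, f a ∈ B) :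
    Nat.card {g : Equiv.Perm α // f ∘ g = f} = ∏ b ∈ B, (Nat.card {a // f a = b})! := by
  rw [Nat.card_eq_fintype_card, DomMulAct.stabilizer_card']
  simp_rw [Nat.card_eq_fintype_card]
  refine Finset.prod_subset (fun b hb => ?_) fun b _ hb => ?_
  · obtain ⟨a, -, rfl⟩ := Finset.mem_image.mp hb; exact hB a
  · have : IsEmpty {a // f a = b} := ⟨fun a => hb (Finset.mem_image.mpr ⟨a, by simp, a.2⟩)⟩
    simp

/-- The number of functions with prescribed fibre sizes `c` and prescribed colours `κ`. -/
theorem card_prescribed_fibres {α β K : Type*} [Fintype α] [DecidableEq β] [DecidableEq K]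
    (B : Finset β) (c : β → ℕ) (hc : ∀ b, b ∉ B → c b = 0) (γ : β → K) (κ : α → K)
    (C : Finset K) (hC : ∀ a, κ a ∈ C)
    (hsum : ∀ k, ∑ b ∈ B with γ b = k, c b = Nat.card {a // κ a = k}) :
    Nat.card {f : α → β // (∀ b, Nat.card {a // f a = b} = c b) ∧ γ ∘ f = κ} * ∏ b ∈ B, (c b)! =
      ∏ k ∈ C, (Nat.card {a // κ a = k})! := by
  classical
  -- A first function comes from taking `c b` copies of each `b` and matching these copies with `α`
  -- colour by colour; `hsum` makes the cardinalities agree.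
  have hex : ∃ f₀ : α → β, (∀ b, Nat.card {a // f₀ a = b} = c b) ∧ γ ∘ f₀ = κ := by
    have e : ∀ k, Nonempty ({a // κ a = k} ≃ {y : Σ b : B, Fin (c b) // γ y.1 = k}) := by
      intro k
      refine Finite.card_eq.mp ?_
      rw [← hsum k]
      have e1 : {y : Σ b : B, Fin (c b) // γ y.1 = k} ≃
          Σ b : {b : B // γ b = k}, Fin (c b) :=
        Equiv.subtypeSigmaEquiv (fun b : B => Fin (c b)) fun b => γ b = k
      rw [Nat.card_congr e1, Nat.card_sigma]
      simp only [Nat.card_eq_fintype_card, Fintype.card_fin]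
      rw [Finset.sum_filter, ← Finset.sum_coe_sort B, ← Finset.sum_filter]
      refine (Finset.sum_subtype _ ?_ _)
      simp
    let E : α ≃ Σ b : B, Fin (c b) :=
      Equiv.ofFiberEquiv (f := κ) (g := fun y : Σ b : B, Fin (c b) => γ y.1) fun k => (e k).some
    refine ⟨fun a => (E a).1, fun b => ?_, ?_⟩
    · rw [Nat.card_congr (E.subtypeEquiv (q := fun y => (y.1 : β) = b) fun a => Iff.rfl)]
      by_cases hb : b ∈ B
      · have e2 : Fin (c b) ≃ {y : Σ b : B, Fin (c b) // (y.1 : β) = b} :=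
          { toFun := fun i => ⟨⟨⟨b, hb⟩, i⟩, rfl⟩
            invFun := fun y => Fin.cast (by rw [y.2]) y.1.2
            left_inv := fun i => rfl
            right_inv := by rintro ⟨⟨⟨b', hb'⟩, i⟩, rfl⟩; rfl }
        rw [← Nat.card_congr e2]; simp
      · rw [hc b hb]
        have : IsEmpty {y : Σ b : B, Fin (c b) // (y.1 : β) = b} :=
          ⟨fun y => hb (by rw [← y.2]; exact y.1.1.2)⟩
        simp
    · funext a
      exact Equiv.ofFiberEquiv_map (g := fun y : Σ b : B, Fin (c b) => γ y.1)
        (fun k => (e k).some) a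
  obtain ⟨f₀, hf₀, hγ₀⟩ := hex
  have hf₀B : ∀ a, f₀ a ∈ B := by
    intro a
    by_contra h
    have h1 := hf₀ (f₀ a)
    rw [hc _ h, Nat.card_eq_zero] at h1
    rcases h1 with h1 | h1
    · exact h1.false ⟨a, rfl⟩
    · exact h1.not_finite inferInstance
  set X := {f : α → β // (∀ b, Nat.card {a // f a = b} = c b) ∧ γ ∘ f = κ} with hX
  have hfinX : Finite X := by
    refine Finite.of_injective (β := α → B) (fun f a => ⟨f.1 a, ?_⟩) ?_
    · by_contra h
      have h1 := f.2.1 (f.1 a)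
      rw [hc _ h, Nat.card_eq_zero] at h1
      rcases h1 with h1 | h1
      · exact h1.false ⟨a, rfl⟩
      · exact h1.not_finite inferInstance
    · intro f f' h
      ext a
      exact congrArg Subtype.val (congrFun h a)
  have := Fintype.ofFinite X
  -- Colour-preserving permutations are fibred over the functions to be counted by `g ↦ f₀ ∘ g`;
  -- each fibre has the size `∏ (c b)!` of the stabilizer of `f₀`.
  have e3 : {g : Equiv.Perm α // κ ∘ g = κ} ≃ Σ f : X, {g : Equiv.Perm α // f₀ ∘ g = f.1} :=
    { toFun := fun g => ⟨⟨f₀ ∘ g.1, fun b => by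
          rw [← hf₀ b]
          exact Nat.card_congr (g.1.subtypeEquiv fun a => Iff.rfl), by
          rw [← Function.comp_assoc, hγ₀, g.2]⟩, ⟨g.1, rfl⟩⟩
      invFun := fun y => ⟨y.2.1, by
          have h : (γ ∘ f₀) ∘ y.2.1 = κ := by
            rw [Function.comp_assoc, y.2.2, y.1.2.2]
          rwa [hγ₀] at h⟩
      left_inv := fun g => rfl
      right_inv := by
        rintro ⟨⟨f, hf⟩, ⟨g, hg⟩⟩
        obtain rfl : f₀ ∘ g = f := hg
        rfl }
  have h4 := Nat.card_congr e3
  rw [card_perm_comp_self κ C hC, Nat.card_sigma] at h4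
  rw [h4, Finset.sum_congr rfl fun f _ =>
    card_perm_comp_eq f₀ f.1 fun b => (f.2.1 b).trans (hf₀ b).symm,
    card_perm_comp_self f₀ B hf₀B]
  simp only [hf₀, Finset.sum_const, Finset.card_univ, smul_eq_mul, Nat.card_eq_fintype_card]

end FibreCount

/-! ### Rooted trees and parent functions -/

section RootedTrees

namespace RootedCayleyTree

variable {N : ℕ}

theorem adj_iff (T : RootedCayleyTree N) (w v : Fin N) :
    T.graph.Adj w v ↔ T.IsParent w v ∨ T.IsParent v w := by
  constructor
  · intro h
    rcases T.isTree.dist_eq_dist_add_one_of_adj T.root h with h1 | h1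
    · exact Or.inr ⟨h.symm, h1⟩
    · exact Or.inl ⟨h, h1⟩
  · rintro (h | h)
    · exact h.1
    · exact h.1.symm

theorem ext_of_isParent {T T' : RootedCayleyTree N} (hroot : T.root = T'.root)
    (h : ∀ w v, T.IsParent w v ↔ T'.IsParent w v) : T = T' := by
  have hg : T.graph = T'.graph := by
    ext w v
    rw [adj_iff, adj_iff, h, h]
  cases T; cases T'
  simp only at hroot hg
  subst hroot hg
  rfl

theorem not_isParent_root (T : RootedCayleyTree N) (w : Fin N) : ¬ T.IsParent w T.root := by
  intro h
  have := h.2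
  simp at this

/-- The parent is the penultimate vertex of the path from the root. Any parent extends a geodesic
from the root to a path ending at `v`, and that path is unique. -/
theorem existsUnique_isParent (T : RootedCayleyTree N) {v : Fin N} (hv : v ≠ T.root) :
    ∃! w, T.IsParent w v := by
  have hc := T.isTree.connected
  obtain ⟨p, hp, hlen⟩ := hc.exists_path_of_dist T.root v
  have hnil : ¬ p.Nil := fun h => hv h.eq.symm
  refine ⟨p.penultimate, ⟨p.adj_penultimate hnil, ?_⟩, ?_⟩
  · have h1 : T.graph.dist T.root p.penultimate ≤ p.dropLast.length :=
      SimpleGraph.dist_le p.dropLast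
    have h2 := T.isTree.dist_eq_dist_add_one_of_adj T.root (p.adj_penultimate hnil)
    have h3 : p.dropLast.length + 1 = p.length := p.length_dropLast_add_one hnil
    omega
  · intro w hw
    obtain ⟨q, hq, hqlen⟩ := hc.exists_path_of_dist T.root w
    have h4 : (q.concat hw.1).IsPath := by
      refine SimpleGraph.Walk.isPath_of_length_eq_dist _ ?_
      rw [SimpleGraph.Walk.length_concat, hqlen, hw.2]
    have h5 := (T.isTree.existsUnique_path T.root v).unique hp h4
    rw [h5, SimpleGraph.Walk.penultimate_concat]

/-- The parent function of a rooted tree (fixing the root). -/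
theorem exists_parent (T : RootedCayleyTree N) :
    ∃ p : Fin N → Fin N, p T.root = T.root ∧ IsRootedAt p T.root ∧
      ∀ w v, T.IsParent w v ↔ v ≠ T.root ∧ p v = w := by
  classical
  have hex : ∀ v, ∃ w, if v = T.root then w = T.root else T.IsParent w v := by
    intro v
    by_cases hv : v = T.root
    · simp [hv]
    · simpa [hv] using (T.existsUnique_isParent hv).exists
  choose p hp using hex
  have hroot : p T.root = T.root := by simpa using hp T.root
  have hpar : ∀ v, v ≠ T.root → T.IsParent (p v) v := fun v hv => by simpa [hv] using hp v
  refine ⟨p, hroot, fun v => ?_, fun w v => ⟨fun h => ?_, fun h => h.2 ▸ hpar v h.1⟩⟩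
  · induction hd : T.graph.dist T.root v generalizing v with
    | zero =>
      rw [T.isTree.connected.dist_eq_zero_iff] at hd
      exact ⟨0, hd.symm⟩
    | succ d ih =>
      have hv : v ≠ T.root := by rintro rfl; simp at hd
      refine IterReach.head (ih _ ?_)
      have := (hpar v hv).2
      omega
  · have hv : v ≠ T.root := by rintro rfl; exact T.not_isParent_root w h
    exact ⟨hv, (T.existsUnique_isParent hv).unique (hpar v hv) h⟩

/-- Every rooted parent function comes from a tree. -/
theorem exists_of_parent {ρ : Fin N} {p : Fin N → Fin N} (hρ : p ρ = ρ) (hp : IsRootedAt p ρ) :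
    ∃ T : RootedCayleyTree N, T.root = ρ ∧ ∀ w v, T.IsParent w v ↔ v ≠ ρ ∧ p v = w := by
  classical
  have hne : ∀ v, v ≠ ρ → p v ≠ v := by
    intro v hv h
    exact hv (IterReach.of_fixed_left h (hp v))
  let G : SimpleGraph (Fin N) :=
    { Adj := fun w v => (v ≠ ρ ∧ p v = w) ∨ (w ≠ ρ ∧ p w = v)
      symm := ⟨fun w v h => h.symm⟩
      loopless := ⟨fun v h => by
        rcases h with h | h
        · exact hne v h.1 h.2
        · exact hne v h.1 h.2⟩ }
  let d : Fin N → ℕ := fun v => Nat.find (hp v)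
  have hd0 : d ρ = 0 := by
    have : d ρ ≤ 0 := Nat.find_min' _ rfl
    omega
  have hd : ∀ v, v ≠ ρ → d v = d (p v) + 1 := by
    intro v hv
    have h0 : p^[d v] v = ρ := Nat.find_spec (hp v)
    have hpos : d v ≠ 0 := by
      intro h; rw [h] at h0; exact hv h0
    obtain ⟨k, hk⟩ := Nat.exists_eq_succ_of_ne_zero hpos
    apply le_antisymm
    · exact Nat.find_min' (hp v) (Nat.find_spec (hp (p v)))
    · have h1 : d (p v) ≤ k := by
        refine Nat.find_min' (hp (p v)) ?_
        rw [hk] at h0; exact h0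
      omega
  have hadj : ∀ v, v ≠ ρ → G.Adj (p v) v := fun v hv => Or.inl ⟨hv, rfl⟩
  have hwalk : ∀ v, ∃ q : G.Walk ρ v, q.length = d v := by
    intro v
    induction hdv : d v generalizing v with
    | zero =>
      have h0 : p^[d v] v = ρ := Nat.find_spec (hp v)
      rw [hdv] at h0
      obtain rfl : v = ρ := h0
      exact ⟨SimpleGraph.Walk.nil, rfl⟩
    | succ k ih =>
      have hv : v ≠ ρ := by rintro rfl; omega
      obtain ⟨q, hq⟩ := ih (p v) (by have := hd v hv; omega)
      exact ⟨q.concat (hadj v hv), by simp [hq]⟩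
  -- The number `d` of iterations needed to reach `ρ` changes by exactly one along an edge, so no
  -- walk from `ρ` to `v` is shorter than `d v`.
  have hlow : ∀ u v (q : G.Walk u v), d v ≤ d u + q.length := by
    intro u v q
    induction q with
    | nil => simp
    | cons h q ih =>
      rename_i a b c
      rw [SimpleGraph.Walk.length_cons]
      rcases h with ⟨h1, h2⟩ | ⟨h1, h2⟩
      · have := hd _ h1; rw [h2] at this; omega
      · have := hd _ h1; rw [h2] at this; omega
  have hconn : G.Connected := by
    have hr : ∀ v, G.Reachable ρ v := fun v => (hwalk v).elim fun q _ => ⟨q⟩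
    have : Nonempty (Fin N) := ⟨ρ⟩
    exact SimpleGraph.Connected.mk fun u v => (hr u).symm.trans (hr v)
  have hdist : ∀ v, G.dist ρ v = d v := by
    intro v
    obtain ⟨q, hq⟩ := hwalk v
    obtain ⟨q', hq'⟩ := hconn.exists_walk_length_eq_dist ρ v
    have h1 := SimpleGraph.dist_le q
    have h2 := hlow _ _ q'
    omega
  have htree : G.IsTree := by
    rw [SimpleGraph.isTree_iff_connected_and_card]
    refine ⟨hconn, le_antisymm ?_ hconn.card_vert_le_card_edgeSet_add_one⟩
    -- Every edge joins some `v ≠ ρ` to `p v`, so there are at most `N - 1` edges, and a connected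
    -- graph with so few edges is a tree.
    have hsub : G.edgeSet ⊆ ((Finset.univ.erase ρ).image fun v => s(p v, v) : Set (Sym2 (Fin N))) := by
      intro e
      induction e using Sym2.ind with
      | h w v =>
        intro h
        rw [SimpleGraph.mem_edgeSet] at h
        simp only [Finset.coe_image, Set.mem_image, Finset.mem_coe, Finset.mem_erase,
          Finset.mem_univ, and_true]
        rcases h with ⟨h1, h2⟩ | ⟨h1, h2⟩
        · exact ⟨v, h1, by rw [h2]⟩
        · exact ⟨w, h1, by rw [h2, Sym2.eq_swap]⟩
    have h1 := Set.ncard_le_ncard hsub (Finset.finite_toSet _)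
    rw [Set.ncard_coe_finset] at h1
    have h2 : ((Finset.univ.erase ρ).image fun v => s(p v, v)).card ≤ N - 1 := by
      refine Finset.card_image_le.trans ?_
      rw [Finset.card_erase_of_mem (Finset.mem_univ ρ)]; simp
    have h3 : 0 < N := Fin.pos ρ
    rw [Nat.card_coe_set_eq, Nat.card_eq_fintype_card, Fintype.card_fin]
    omega
  refine ⟨⟨G, htree, ρ⟩, rfl, fun w v => ?_⟩
  change G.Adj w v ∧ G.dist ρ v = G.dist ρ w + 1 ↔ _
  rw [hdist, hdist]
  constructor
  · rintro ⟨h | h, h2⟩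
    · exact h
    · have := hd w h.1
      rw [h.2] at this
      omega
  · rintro ⟨h1, rfl⟩
    exact ⟨hadj v h1, hd v h1⟩

end RootedCayleyTree

end RootedTrees

/-! ### Encoding embedded trees by types and parent functions -/

section Encoding

/-- The complete types `(i; s; c)`. -/
abbrev VertexType (m : ℤ) : Type := ℤ × ↥(stepSet m) × ChildVector m

variable {m : ℤ}

/-- The abscissa recorded by a type; the root has type `none`. -/
def typeLevel (o : Option (VertexType m)) : ℤ := o.elim 0 fun t => t.1

/-- The out-type recorded by a type. -/
def outType (o : Option (VertexType m)) : Option (ℤ × ↥(stepSet m)) := o.map fun t => (t.1, t.2.1)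

/-- The child vector recorded by a type. -/
noncomputable def typeVector (c₀ : ℕ) (o : Option (VertexType m)) : ChildVector m :=
  o.elim (rootVector m c₀) fun t => t.2.2

@[simp] theorem typeLevel_none : typeLevel (none : Option (VertexType m)) = 0 := rfl
@[simp] theorem typeLevel_some (t : VertexType m) : typeLevel (some t) = t.1 := rfl
@[simp] theorem outType_none : outType (none : Option (VertexType m)) = none := rfl
@[simp] theorem outType_some (t : VertexType m) : outType (some t) = some (t.1, t.2.1) := rfl
@[simp] theorem typeVector_none (c₀ : ℕ) :
    typeVector c₀ (none : Option (VertexType m)) = rootVector m c₀ := rfl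
@[simp] theorem typeVector_some (c₀ : ℕ) (t : VertexType m) :
    typeVector c₀ (some t) = t.2.2 := rfl

@[simp] theorem outType_eq_none {o : Option (VertexType m)} : outType o = none ↔ o = none := by
  simp [outType]

theorem stepSet_subset (hm : m ≤ 1) {s : ℤ} (hs : s ∈ stepSet m) : s ∈ Finset.Icc m 1 := by
  simp only [stepSet, Finset.mem_insert, Finset.mem_Icc] at hs ⊢
  omega

theorem mem_stepSet_of_ne_zero {k : ℤ} (hk : k ∈ Finset.Icc m 1) (h0 : k ≠ 0) : k ∈ stepSet m := by
  simp only [stepSet, Finset.mem_insert, Finset.mem_Icc] at hk ⊢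
  omega

theorem eq_one_or_neg {s : ℤ} (hs : s ∈ stepSet m) : s = 1 ∨ s < 0 := by
  simp only [stepSet, Finset.mem_insert, Finset.mem_Icc] at hs
  omega

theorem ChildVector.coord_of_mem (c : ChildVector m) {k : ℤ} (hk : k ∈ Finset.Icc m 1) :
    c.coord k = c ⟨k, hk⟩ := dif_pos hk

/-- `p` is a parent function compatible with the types `τ`. -/
structure IsParentMap {V : Type*} (c₀ : ℕ) (τ : V → Option (VertexType m)) (p : V → V) : Prop where
  root : ∀ v, τ v = none → p v = v
  level : ∀ v t, τ v = some t → typeLevel (τ (p v)) = t.1 - t.2.1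
  children : ∀ w (s : ↥(stepSet m)),
    Nat.card {v // (τ v).map (fun t => t.2.1) = some s ∧ p v = w} = (typeVector c₀ (τ w)).coord s

/-- Every vertex has an ancestor of type `none`. -/
def IsRootedType {V : Type*} (τ : V → Option (VertexType m)) (p : V → V) : Prop :=
  ∀ v, ∃ k : ℕ, τ (p^[k] v) = none

theorem isRootedType_iff {V : Type*} {τ : V → Option (VertexType m)} {p : V → V} {ρ : V}
    (hρ : ∀ v, v = ρ ↔ τ v = none) : IsRootedType τ p ↔ IsRootedAt p ρ := by
  simp only [IsRootedType, IsRootedAt, IterReach, hρ]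

namespace EmbeddedCayleyTree

variable {N : ℕ}

/-- The tree `T` has parent function `p`, and the types `τ` record its abscissas. -/
structure Encodes (T : EmbeddedCayleyTree (stepSet m) N) (τ : Fin N → Option (VertexType m))
    (p : Fin N → Fin N) : Prop where
  root_iff : ∀ v, v = T.root ↔ τ v = none
  abscissa_eq : ∀ v, T.abscissa v = typeLevel (τ v)
  parent_root : p T.root = T.root
  isParent_iff : ∀ w v, T.IsParent w v ↔ v ≠ T.root ∧ p v = w
  level : ∀ v t, τ v = some t → T.abscissa (p v) = t.1 - t.2.1

variable {T : EmbeddedCayleyTree (stepSet m) N} {τ : Fin N → Option (VertexType m)}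
  {p : Fin N → Fin N}

theorem Encodes.childVector_apply (h : T.Encodes τ p) (w : Fin N) (s : ↥(stepSet m))
    (hs : (s : ℤ) ∈ Finset.Icc m 1) :
    T.childVector m w ⟨s, hs⟩ = Nat.card {v // (τ v).map (fun t => t.2.1) = some s ∧ p v = w} := by
  rw [childVector, ← Nat.card_coe_set_eq]
  refine Nat.card_congr (Equiv.subtypeEquivRight fun v => ?_)
  simp only [Set.mem_ofPred_eq]
  rw [h.isParent_iff]
  constructor
  · rintro ⟨⟨h1, rfl⟩, h2⟩
    rw [Ne, h.root_iff] at h1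
    obtain ⟨t, ht⟩ := Option.ne_none_iff_exists'.mp h1
    have h3 := h.level v t ht
    rw [h.abscissa_eq v, ht, typeLevel_some, h3] at h2
    simp only [ht, Option.map_some, and_true, Option.some.injEq]
    ext; linarith
  · rintro ⟨h1, rfl⟩
    obtain ⟨t, ht, rfl⟩ := Option.map_eq_some_iff.mp h1
    refine ⟨⟨?_, rfl⟩, ?_⟩
    · rw [Ne, h.root_iff, ht]; simp
    · rw [h.abscissa_eq v, ht, typeLevel_some, h.level v t ht]; ring

theorem childVector_of_notMem (T : EmbeddedCayleyTree (stepSet m) N) (w : Fin N)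
    (k : ↥(Finset.Icc m 1)) (hk : (k : ℤ) ∉ stepSet m) : T.childVector m w k = 0 := by
  rw [childVector, Set.ncard_eq_zero, Set.eq_empty_iff_forall_notMem]
  rintro v ⟨h1, h2⟩
  have := T.step_mem w v h1
  rw [h2, add_sub_cancel_left] at this
  exact hk this

/-- This makes `τ` intrinsic to the tree: it is recovered from the complete types, which gives both
the vertex counts and the uniqueness of the encoding. -/
theorem Encodes.hasType_iff (h : T.Encodes τ p) (c₀ : ℕ)
    (hc : ∀ v, T.childVector m v = typeVector c₀ (τ v)) (v : Fin N) (t : VertexType m) :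
    T.HasType v t.1 t.2.1 t.2.2 ↔ τ v = some t := by
  rw [HasType, Ne, h.root_iff]
  constructor
  · rintro ⟨h1, h2, ⟨w, h3, h4⟩, h5⟩
    obtain ⟨t', ht'⟩ := Option.ne_none_iff_exists'.mp h1
    rw [h.isParent_iff] at h3
    obtain ⟨h3, rfl⟩ := h3
    rw [h.level v t' ht'] at h4
    rw [hc, ht', typeVector_some] at h5
    rw [h.abscissa_eq, ht', typeLevel_some] at h2
    rw [ht', Option.some.injEq]
    obtain ⟨i, s, c⟩ := t
    obtain ⟨i', s', c'⟩ := t'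
    simp only at h2 h4 h5
    subst h2 h5
    have : s' = s := by ext; linarith
    rw [this]
  · intro ht
    refine ⟨by simp [ht], by rw [h.abscissa_eq, ht, typeLevel_some], ⟨p v, ?_, h.level v t ht⟩, ?_⟩
    · rw [h.isParent_iff, Ne, h.root_iff]; simp [ht]
    · rw [hc, ht, typeVector_some]

theorem Encodes.isRootedType (h : T.Encodes τ p) : IsRootedType τ p := by
  rw [isRootedType_iff h.root_iff]
  obtain ⟨p', h1, h2, h3⟩ := T.exists_parent
  suffices p' = p from this ▸ h2
  funext v
  by_cases hv : v = T.root
  · rw [hv, h1, h.parent_root]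
  · exact ((h.isParent_iff _ _).mp ((h3 _ _).mpr ⟨hv, rfl⟩)).2.symm

theorem exists_encodes (T : EmbeddedCayleyTree (stepSet m) N) (c₀ : ℕ)
    (hroot : T.childVector m T.root = rootVector m c₀) :
    ∃ τ p, T.Encodes τ p ∧ ∀ v, T.childVector m v = typeVector c₀ (τ v) := by
  classical
  obtain ⟨p, h1, h2, h3⟩ := T.exists_parent
  refine ⟨fun v => if hv : v = T.root then none else
    some (T.abscissa v, ⟨T.abscissa v - T.abscissa (p v),
      T.step_mem _ _ ((h3 _ _).mpr ⟨hv, rfl⟩)⟩, T.childVector m v), p,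
    ⟨fun v => ?_, fun v => ?_, h1, h3, fun v t ht => ?_⟩, fun v => ?_⟩
  · by_cases hv : v = T.root <;> simp [hv]
  · by_cases hv : v = T.root
    · simp [hv, T.abscissa_root]
    · simp [hv]
  · by_cases hv : v = T.root
    · simp [hv] at ht
    · simp only [hv, dif_neg, not_false_eq_true, Option.some.injEq] at ht
      subst ht
      simp
  · by_cases hv : v = T.root
    · simp [hv, hroot]
    · simp [hv]

theorem exists_encodes_of_isParentMap {c₀ : ℕ} {ρ : Fin N} (hρ : ∀ v, v = ρ ↔ τ v = none)
    (hp : IsParentMap c₀ τ p) (hr : IsRootedType τ p) :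
    ∃ T : EmbeddedCayleyTree (stepSet m) N, T.Encodes τ p := by
  obtain ⟨T, h1, h2⟩ := RootedCayleyTree.exists_of_parent (hp.root ρ ((hρ ρ).mp rfl))
    ((isRootedType_iff hρ).mp hr)
  subst h1
  refine ⟨⟨T, fun v => typeLevel (τ v), ?_, ?_⟩, ⟨hρ, fun _ => rfl, ?_, h2, hp.level⟩⟩
  · rw [(hρ T.root).mp rfl, typeLevel_none]
  · intro w v h
    obtain ⟨h3, rfl⟩ := (h2 w v).mp h
    rw [Ne, hρ] at h3
    obtain ⟨t, ht⟩ := Option.ne_none_iff_exists'.mp h3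
    rw [hp.level v t ht, ht, typeLevel_some, sub_sub_cancel]
    exact t.2.1.2
  · exact hp.root _ ((hρ T.root).mp rfl)

theorem Encodes.type_unique {τ' : Fin N → Option (VertexType m)} {p' : Fin N → Fin N} {c₀ : ℕ}
    (h : T.Encodes τ p) (hc : ∀ v, T.childVector m v = typeVector c₀ (τ v))
    (h' : T.Encodes τ' p') (hc' : ∀ v, T.childVector m v = typeVector c₀ (τ' v)) :
    τ = τ' ∧ p = p' := by
  constructor
  · funext v
    rcases hv : τ v with _ | t
    · exact ((h'.root_iff v).mp ((h.root_iff v).mpr hv)).symm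
    · exact ((h'.hasType_iff c₀ hc' v t).mp ((h.hasType_iff c₀ hc v t).mpr hv)).symm
  · funext v
    by_cases hv : v = T.root
    · rw [hv, h.parent_root, h'.parent_root]
    · exact ((h'.isParent_iff _ _).mp ((h.isParent_iff _ _).mpr ⟨hv, rfl⟩)).2.symm

theorem Encodes.tree_unique {T' : EmbeddedCayleyTree (stepSet m) N} (h : T.Encodes τ p)
    (h' : T'.Encodes τ p) : T = T' := by
  have hroot : T.root = T'.root := (h'.root_iff _).mpr ((h.root_iff _).mp rfl)
  have h1 : T.toRootedCayleyTree = T'.toRootedCayleyTree :=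
    RootedCayleyTree.ext_of_isParent hroot fun w v => by
      rw [h.isParent_iff, h'.isParent_iff, hroot]
  have h2 : T.abscissa = T'.abscissa := by
    funext v; rw [h.abscissa_eq, h'.abscissa_eq]
  clear h h' hroot
  obtain ⟨T₁, a₁, x₁, y₁⟩ := T
  obtain ⟨T₂, a₂, x₂, y₂⟩ := T'
  simp only at h1 h2
  subst h1 h2
  rfl

end EmbeddedCayleyTree

namespace TypeDistribution

/-- The assignment `τ` of types to the vertices has `n t` vertices of each type `t`. -/
def IsTypeAssignment (n : TypeDistribution m) (τ : Fin n.size → Option (VertexType m)) : Prop :=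
  ∀ t, Nat.card {v // τ v = some t} = n t

/-- The prescribed types account for all vertices but one. The remaining vertex cannot carry any
`some t`, whose multiplicity is already exhausted, so it is the root. -/
theorem IsTypeAssignment.map_univ {n : TypeDistribution m} {τ : Fin n.size → Option (VertexType m)}
    (h : n.IsTypeAssignment τ) :
    (Finset.univ.val.map τ : Multiset (Option (VertexType m))) =
      none ::ₘ (Finsupp.toMultiset n).map some := by
  classical
  have hcount : ∀ t, (Finset.univ.val.map τ).count (some t) = n t := by
    intro t
    rw [Multiset.count_map, ← h t, Nat.card_eq_fintype_card, Fintype.card_subtype]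
    simp only [Finset.card, Finset.filter_val, eq_comm]
  have hle : (Finsupp.toMultiset n).map some ≤ Finset.univ.val.map τ := by
    rw [Multiset.le_iff_count]
    rintro (_ | t)
    · rw [Multiset.count_eq_zero_of_notMem (by simp)]; exact Nat.zero_le _
    · rw [hcount, Multiset.count_map_eq_count' _ _ (Option.some_injective _),
        Finsupp.count_toMultiset]
  obtain ⟨R, hR⟩ := Multiset.le_iff_exists_add.mp hle
  have hcard := congrArg Multiset.card hR
  have hRnone : ∀ o ∈ R, o = none := by
    rintro (_ | t) ho
    · rfl
    · have h1 := congrArg (Multiset.count (some t)) hR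
      rw [Multiset.count_add, hcount, Multiset.count_map_eq_count' _ _ (Option.some_injective _),
        Finsupp.count_toMultiset] at h1
      have := Multiset.count_pos.mpr ho
      omega
  rw [Multiset.card_add, Multiset.card_map, Multiset.card_map, Finsupp.card_toMultiset] at hcard
  simp only [Finset.card_val, Finset.card_univ, Fintype.card_fin] at hcard
  have hR1 : Multiset.card R = 1 := by
    rw [size] at hcard
    simp only [Finsupp.sum] at hcard ⊢
    simp only [id] at hcard
    omega
  obtain ⟨o, rfl⟩ := Multiset.card_eq_one.mp hR1
  rw [hR, hRnone o (by simp), add_comm, Multiset.singleton_add]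

/-- This converts products over vertices into products over types, which no longer depend on `τ`. -/
theorem IsTypeAssignment.prod_eq {n : TypeDistribution m} {τ : Fin n.size → Option (VertexType m)}
    (h : n.IsTypeAssignment τ) {M : Type*} [CommMonoid M] (g : Option (VertexType m) → M) :
    ∏ v, g (τ v) = g none * n.prod fun t k => g (some t) ^ k := by
  have h1 := congrArg (fun s => (s.map g).prod) h.map_univ
  simp only [Multiset.map_map, Multiset.map_cons, Multiset.prod_cons] at h1
  have h2 : n.prod (fun t k => g (some t) ^ k) =
      ((Finsupp.toMultiset n).map fun t => g (some t)).prod := by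
    rw [Finsupp.toMultiset_map, Finsupp.prod_toMultiset,
      Finsupp.prod_mapDomain_index (fun _ => pow_zero _) fun _ _ _ => pow_add _ _ _]
  rw [h2]; exact h1

theorem IsTypeAssignment.sum_eq {n : TypeDistribution m} {τ : Fin n.size → Option (VertexType m)}
    (h : n.IsTypeAssignment τ) (g : Option (VertexType m) → ℕ) :
    ∑ v, g (τ v) = g none + n.sum fun t k => k * g (some t) :=
  h.prod_eq (M := Multiplicative ℕ) fun o => Multiplicative.ofAdd (g o)

theorem IsTypeAssignment.exists_root {n : TypeDistribution m}
    {τ : Fin n.size → Option (VertexType m)} (h : n.IsTypeAssignment τ) :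
    ∃ ρ, ∀ v, v = ρ ↔ τ v = none := by
  classical
  have h1 := congrArg (Multiset.count none) h.map_univ
  rw [Multiset.count_cons_self, Multiset.count_eq_zero_of_notMem (a := none) (s := Multiset.map some _)
    (by simp), Multiset.count_map] at h1
  rw [zero_add, Multiset.card_eq_one] at h1
  obtain ⟨ρ, hρ⟩ := h1
  refine ⟨ρ, fun v => ?_⟩
  have h2 : v ∈ Multiset.filter (fun v => none = τ v) Finset.univ.val ↔ v ∈ ({ρ} : Multiset _) := by
    rw [hρ]
  rw [Multiset.mem_filter, Multiset.mem_singleton] at h2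
  simp only [Finset.mem_val, Finset.mem_univ, true_and] at h2
  rw [← h2, eq_comm]

theorem IsTypeAssignment.pos {n : TypeDistribution m}
    {τ : Fin n.size → Option (VertexType m)} (h : n.IsTypeAssignment τ) {v : Fin n.size}
    {t : VertexType m} (hv : τ v = some t) : 0 < n t := by
  rw [← h t]
  have : Nonempty {v // τ v = some t} := ⟨⟨v, hv⟩⟩
  exact Nat.card_pos

/-- Trees correspond to rooted parent functions of type assignments. -/
theorem numTrees_eq (hm : m ≤ 1) (c₀ : ℕ) (n : TypeDistribution m)
    (hzero : ∀ (i : ℤ) (s : ↥(stepSet m)) (c : ChildVector m),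
      0 < c.coord 0 → n (i, s, c) = 0) :
    n.numTrees c₀ = Nat.card {x : (Fin n.size → Option (VertexType m)) × (Fin n.size → Fin n.size) //
      n.IsTypeAssignment x.1 ∧ IsParentMap c₀ x.1 x.2 ∧ IsRootedType x.1 x.2} := by
  have E1 : ∀ T : EmbeddedCayleyTree (stepSet m) n.size,
      T.childVector m T.root = rootVector m c₀ ∧
        (∀ (i : ℤ) (s : ↥(stepSet m)) (c : ChildVector m),
          {v | T.HasType v i s c}.ncard = n (i, s, c)) →
      ∃ x : {x : (Fin n.size → Option (VertexType m)) × (Fin n.size → Fin n.size) //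
        n.IsTypeAssignment x.1 ∧ IsParentMap c₀ x.1 x.2 ∧ IsRootedType x.1 x.2},
        T.Encodes x.1.1 x.1.2 ∧ ∀ v, T.childVector m v = typeVector c₀ (x.1.1 v) := by
    rintro T ⟨h1, h2⟩
    obtain ⟨τ, p, h3, h4⟩ := T.exists_encodes c₀ h1
    refine ⟨⟨(τ, p), ?_, ⟨?_, ?_, ?_⟩, h3.isRootedType⟩, h3, h4⟩
    · intro t
      rw [← h2 t.1 t.2.1 t.2.2, ← Nat.card_coe_set_eq]
      exact Nat.card_congr (Equiv.subtypeEquivRight fun v => (h3.hasType_iff c₀ h4 v t).symm)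
    · intro v hv
      rw [← h3.root_iff] at hv
      rw [hv]; exact h3.parent_root
    · intro v t hv
      rw [← h3.abscissa_eq]; exact h3.level v t hv
    · intro w s
      rw [← h4, ChildVector.coord_of_mem _ (stepSet_subset hm s.2), h3.childVector_apply]
  choose f hf1 hf2 using E1
  refine Nat.card_eq_of_bijective (fun T => f T.1 T.2) ⟨?_, ?_⟩
  · intro T T' h
    have e1 := hf1 T.1 T.2
    have e2 := hf1 T'.1 T'.2
    simp only at h
    rw [h] at e1
    exact Subtype.ext (e1.tree_unique e2)
  · rintro ⟨⟨τ, p⟩, h1, h2, h3⟩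
    simp only at h1 h2 h3
    obtain ⟨ρ, hρ⟩ := h1.exists_root
    obtain ⟨T, hT⟩ := EmbeddedCayleyTree.exists_encodes_of_isParentMap hρ h2 h3
    have hc : ∀ v, T.childVector m v = typeVector c₀ (τ v) := by
      intro v
      funext k
      -- The fibres of `p` control only the components indexed by steps. The only other index is
      -- `0`, where the tree has no children and `hzero` makes the recorded component vanish.
      by_cases hk : (k : ℤ) ∈ stepSet m
      · have := hT.childVector_apply v ⟨k, hk⟩ k.2
        rw [this, h2.children, ChildVector.coord_of_mem _ k.2]
      · have hk0 : (k : ℤ) = 0 := by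
          by_contra h0
          exact hk (mem_stepSet_of_ne_zero k.2 h0)
        rw [T.childVector_of_notMem v k hk]
        rcases hv : τ v with _ | ⟨i, s, c⟩
        · simp [rootVector, hk0]
        · have h5 := h1.pos hv
          by_contra h6
          refine h5.ne' (hzero i s c ?_)
          rw [← hk0, ChildVector.coord_of_mem c k.2]
          exact Nat.pos_of_ne_zero fun h => h6 (by simpa using h.symm)
    have hgood : T.childVector m T.root = rootVector m c₀ ∧
        (∀ (i : ℤ) (s : ↥(stepSet m)) (c : ChildVector m),
          {v | T.HasType v i s c}.ncard = n (i, s, c)) := by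
      refine ⟨?_, fun i s c => ?_⟩
      · rw [hc, (hT.root_iff _).mp rfl, typeVector_none]
      · rw [← h1 (i, s, c), ← Nat.card_coe_set_eq]
        exact Nat.card_congr
          (Equiv.subtypeEquivRight fun v => hT.hasType_iff c₀ hc v (i, s, c))
    refine ⟨⟨T, hgood⟩, Subtype.ext ?_⟩
    have h8 := (hf1 T hgood).type_unique (hf2 T hgood) hT hc
    exact Prod.ext h8.1 h8.2

end TypeDistribution

end Encoding

/-! ### Rootedness after collapsing the out-types -/

section Chains

variable {m : ℤ}

/-- The increment `1`, as an element of `stepSet m`. -/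
def upStep (m : ℤ) : ↥(stepSet m) := ⟨1, by simp [stepSet]⟩

/-- The out-type of the parent of a vertex of out-type `(i; 1)`, on the path from the root which
uses only increments `1`. -/
def chainType (m i : ℤ) : Option (ℤ × ↥(stepSet m)) :=
  if i = 1 then none else some (i - 1, upStep m)

theorem typeLevel_eq_of_outType {o o' : Option (VertexType m)} (h : outType o = outType o') :
    typeLevel o = typeLevel o' := by
  rcases o with _ | t <;> rcases o' with _ | t'
  · rfl
  · simp at h
  · simp at h
  · simp only [outType_some, Option.some.injEq, Prod.mk.injEq] at h
    exact h.1

theorem outType_eq_some {o : Option (VertexType m)} {i : ℤ} {s : ↥(stepSet m)}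
    (h : outType o = some (i, s)) : ∃ t, o = some t ∧ t.1 = i ∧ t.2.1 = s := by
  rcases o with _ | t
  · simp at h
  · simp only [outType_some, Option.some.injEq, Prod.mk.injEq] at h
    exact ⟨t, rfl, h.1, h.2⟩

variable {V : Type*} {τ : V → Option (VertexType m)}

/-- A path from level at least `i ≥ 1` to the root visits a vertex of out-type `(i; 1)`. -/
theorem exists_outType_of_path {f : V → V}
    (hf : ∀ v t, τ v = some t → typeLevel (τ (f v)) = t.1 - t.2.1) {i : ℤ} (hi : 1 ≤ i) {z : V}
    (hz : i ≤ typeLevel (τ z)) {k : ℕ} (hk : τ (f^[k] z) = none) :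
    ∃ j : ℕ, outType (τ (f^[j] z)) = some (i, upStep m) := by
  induction k generalizing z with
  | zero =>
    rw [Function.iterate_zero, id] at hk
    rw [hk, typeLevel_none] at hz
    omega
  | succ k ih =>
    rcases hτ : τ z with _ | t
    · rw [hτ, typeLevel_none] at hz; omega
    have h1 := hf z t hτ
    rw [hτ, typeLevel_some] at hz
    by_cases h2 : t.1 = i ∧ t.2.1 = upStep m
    · exact ⟨0, by rw [Function.iterate_zero, id, hτ, outType_some, h2.1, h2.2]⟩
    -- Only an increment `1` at level `i` can bring the path below `i`; in all other cases it stays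
    -- at level at least `i`.
    have h3 : i ≤ typeLevel (τ (f z)) := by
      rw [h1]
      rcases eq_one_or_neg t.2.1.2 with h4 | h4
      · have : t.1 ≠ i := fun h => h2 ⟨h, Subtype.ext h4⟩
        omega
      · omega
    obtain ⟨j, hj⟩ := ih h3 hk
    exact ⟨j + 1, hj⟩

variable {ρ : V} {p : V → V} {c₀ : ℕ} {r : ℤ} {rep : Option (ℤ × ↥(stepSet m)) → V}

/-- When the vertices of each out-type are merged, a parent function becomes rooted if and only if
the parents of the representatives of the out-types `(i; 1)` have out-type `(i - 1; 1)`. -/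
theorem isRootedAt_rep_iff (hρ : ∀ v, v = ρ ↔ τ v = none) (hp : IsParentMap c₀ τ p)
    (hnonneg : ∀ v, 0 ≤ typeLevel (τ v)) (hr : ∀ v, typeLevel (τ v) ≤ r)
    (hrep : ∀ v, outType (τ (rep (outType (τ v)))) = outType (τ v))
    (hup : ∀ i ∈ Finset.Icc 1 r, ∃ v, outType (τ v) = some (i, upStep m)) :
    IsRootedAt (fun x => rep (outType (τ (p x)))) ρ ↔
      ∀ i ∈ Finset.Icc 1 r, outType (τ (p (rep (some (i, upStep m))))) = chainType m i := by
  set g : V → V := fun x => rep (outType (τ (p x))) with hg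
  have hκg : ∀ x, outType (τ (g x)) = outType (τ (p x)) := fun x => hrep (p x)
  have hlevel : ∀ v t, τ v = some t → typeLevel (τ (g v)) = t.1 - t.2.1 := fun v t hv => by
    rw [typeLevel_eq_of_outType (hκg v), hp.level v t hv]
  have hroot : τ ρ = none := (hρ ρ).mp rfl
  have hrepρ : rep none = ρ := by
    have := hrep ρ
    rw [hroot, outType_none, outType_eq_none, ← hρ] at this
    exact this
  have hgρ : g ρ = ρ := by
    simp only [hg]
    rw [hp.root ρ hroot, hroot, outType_none, hrepρ]
  have hgrep : ∀ x, g x = rep (outType (τ (g x))) := fun x => by rw [hκg]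
  constructor
  · intro H i hi
    have hi1 := (Finset.mem_Icc.mp hi).1
    obtain ⟨v, hv⟩ := hup i hi
    set u := rep (some (i, upStep m)) with hu
    have hκu : outType (τ u) = some (i, upStep m) := by
      rw [hu, ← hv]; exact hrep v
    obtain ⟨t, ht, ht1, ht2⟩ := outType_eq_some hκu
    have huρ : u ≠ ρ := by rw [Ne, hρ, ht]; simp
    have hgu := hlevel u t ht
    rw [ht1, ht2, show ((upStep m : ↥(stepSet m)) : ℤ) = 1 from rfl] at hgu
    rw [← hκg]
    rcases hy : τ (g u) with _ | t'
    · rw [hy, typeLevel_none] at hgu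
      rw [outType_none, chainType, if_pos (by omega)]
    · have hgg := hlevel _ _ hy
      rw [hy, typeLevel_some] at hgu
      rcases eq_one_or_neg t'.2.1.2 with h1 | h1
      · have h2 := hnonneg (g (g u))
        have h3 : t'.2.1 = upStep m := Subtype.ext h1
        rw [outType_some, chainType, if_neg (by omega), hgu, h3]
      -- With a negative increment, the grandparent of `u` is at level at least `i`, so its path
      -- meets the class `(i;1)` again. The vertex met is a value of `g`, hence the representative
      -- `u` itself, and this is a cycle.
      · exfalso
        obtain ⟨k, hk⟩ := H (g (g u))
        obtain ⟨j, hj⟩ := exists_outType_of_path hlevel hi1 (z := g (g u)) (by omega)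
          (k := k) (by rw [hk, hroot])
        refine IterReach.not_root_of_cycle hgρ huρ ?_ (H u)
        refine IterReach.head ⟨j, ?_⟩
        have h4 : g^[j] (g (g u)) = g (g^[j] (g u)) := by
          rw [← Function.iterate_succ_apply, Function.iterate_succ_apply']
        rw [h4] at hj ⊢
        rw [hgrep, hj]
  · intro H
    have hchain : ∀ k : ℕ, (k : ℤ) + 1 ≤ r →
        IterReach g (rep (some ((k : ℤ) + 1, upStep m))) ρ := by
      intro k
      induction k with
      | zero =>
        intro h1
        have h2 := H 1 (Finset.mem_Icc.mpr ⟨le_rfl, by simpa using h1⟩)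
        refine IterReach.head ?_
        simp only [hg, Nat.cast_zero, zero_add, h2, chainType, if_true, hrepρ]
        exact IterReach.refl _ _
      | succ k ih =>
        intro h1
        push_cast at h1
        have h2 := H ((k : ℤ) + 1 + 1) (Finset.mem_Icc.mpr ⟨by omega, h1⟩)
        have h3 : g (rep (some ((k : ℤ) + 1 + 1, upStep m))) = rep (some ((k : ℤ) + 1, upStep m)) := by
          simp only [hg]
          rw [h2, chainType, if_neg (by omega), add_sub_cancel_right]
        refine IterReach.head ?_
        push_cast
        rw [h3]
        exact ih (by omega)
    -- A representative with increment `1` lies on the chain leading to the root; with a negative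
    -- increment its image is strictly higher. Since levels are bounded by `r`, the induction is on
    -- the distance to `r`.
    have hreps : ∀ d : ℕ, ∀ z, z = rep (outType (τ z)) → r - typeLevel (τ z) = d →
        IterReach g z ρ := by
      intro d
      induction d using Nat.strong_induction_on with
      | _ d ih =>
        intro z hz hd
        rcases hτ : τ z with _ | t
        · rw [(hρ z).mpr hτ]; exact IterReach.refl _ _
        have h1 := hlevel z t hτ
        rw [hτ, typeLevel_some] at hd
        have h2 := hnonneg (g z)
        have h3 := hr (g z)
        have h4 := hr z
        rw [hτ, typeLevel_some] at h4
        rcases eq_one_or_neg t.2.1.2 with h5 | h5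
        · have h6 : t.2.1 = upStep m := Subtype.ext h5
          have h7 := hchain (t.1 - 1).toNat (by omega)
          rw [Int.toNat_of_nonneg (by omega), sub_add_cancel, ← h6, ← outType_some, ← hτ, ← hz] at h7
          exact h7
        · exact IterReach.head (ih (r - typeLevel (τ (g z))).toNat (by omega) (g z) (hgrep z)
            (by omega))
    intro x
    refine IterReach.head (hreps (r - typeLevel (τ (g x))).toNat (g x) (hgrep x) ?_)
    have := hr (g x)
    omega

/-- The conditions on `p` involve a vertex only through its out-type, so permuting vertices within
out-types preserves them. This is the exchange invariance needed for merging. -/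
theorem IsParentMap.comp_perm (hρ : ∀ v, v = ρ ↔ τ v = none) (hp : IsParentMap c₀ τ p)
    (g : Equiv.Perm V) (hg : ∀ v, outType (τ (g v)) = outType (τ v)) :
    IsParentMap c₀ τ (p ∘ g) := by
  refine ⟨fun v hv => ?_, fun v t hv => ?_, fun w s => ?_⟩
  · have h1 := hg v
    rw [hv, outType_none, outType_eq_none, ← hρ, ← (hρ v).mpr hv] at h1
    rw [Function.comp_apply, h1]
    exact hp.root v hv
  · have h1 := hg v
    rw [hv, outType_some] at h1
    obtain ⟨t', ht', h2, h3⟩ := outType_eq_some h1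
    rw [Function.comp_apply, hp.level _ t' ht', h2, h3]
  · rw [← hp.children w s]
    refine Nat.card_congr (g.subtypeEquiv fun v => ?_)
    have h1 : ∀ o : Option (VertexType m), o.map (fun t => t.2.1) =
        (outType o).map Prod.snd := fun o => by cases o <;> rfl
    rw [h1, h1, hg]; rfl

-- Since `o` fixes the level `i - 1` of the parents, each of their children with increment `1` has
-- out-type `(i;1)`. The count therefore depends on `τ` alone, not on `p`.
open Classical in
theorem IsParentMap.card_upStep [Fintype V] (hp : IsParentMap c₀ τ p) (i : ℤ)
    (o : Option (ℤ × ↥(stepSet m))) (ho : ∀ w, outType (τ w) = o → typeLevel (τ w) = i - 1) :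
    (Finset.univ.filter fun v => outType (τ v) = some (i, upStep m) ∧
      outType (τ (p v)) = o).card =
    ∑ w, if outType (τ w) = o then (typeVector c₀ (τ w)).coord 1 else 0 := by
  rw [← Finset.sum_filter, Finset.card_eq_sum_card_fiberwise (f := p)
    (t := Finset.univ.filter fun w => outType (τ w) = o) (fun v hv => by
      simp only [Finset.coe_filter, Finset.mem_univ, true_and, Set.mem_ofPred_eq] at hv ⊢
      exact hv.2)]
  refine Finset.sum_congr rfl fun w hw => ?_
  simp only [Finset.mem_filter, Finset.mem_univ, true_and] at hw
  have h1 := hp.children w (upStep m)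
  rw [show ((upStep m : ↥(stepSet m)) : ℤ) = 1 from rfl] at h1
  rw [← h1, Nat.card_eq_fintype_card, Fintype.card_subtype, Finset.filter_filter]
  congr 1
  refine Finset.filter_congr fun v _ => ?_
  constructor
  · rintro ⟨⟨h2, -⟩, h3⟩
    obtain ⟨t, ht, -, h4⟩ := outType_eq_some h2
    exact ⟨by rw [ht, Option.map_some, h4], h3⟩
  · rintro ⟨h2, rfl⟩
    obtain ⟨t, ht, h3⟩ := Option.map_eq_some_iff.mp h2
    have h4 := hp.level v t ht
    rw [ho _ hw, h3, show ((upStep m : ↥(stepSet m)) : ℤ) = 1 from rfl] at h4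
    refine ⟨⟨?_, hw⟩, rfl⟩
    rw [ht, outType_some, h3, show t.1 = i by omega]

open Classical in
/-- Among the parent functions of fixed types, the proportion of rooted ones. -/
theorem card_rooted_mul_prod [Fintype V] (c₀ : ℕ) (hρ : ∀ v, v = ρ ↔ τ v = none)
    (hnonneg : ∀ v, 0 ≤ typeLevel (τ v)) (hr : ∀ v, typeLevel (τ v) ≤ r)
    (hup : ∀ i ∈ Finset.Icc 1 r, ∃ v, outType (τ v) = some (i, upStep m)) :
    (∏ i ∈ Finset.Icc 1 r, (Finset.univ.filter fun v => outType (τ v) = some (i, upStep m)).card) *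
      Nat.card {p : V → V // IsParentMap c₀ τ p ∧ IsRootedType τ p} =
    Nat.card {p : V → V // IsParentMap c₀ τ p} *
      ∏ i ∈ Finset.Icc 1 r,
        ∑ w, if outType (τ w) = chainType m i then (typeVector c₀ (τ w)).coord 1 else 0 := by
  set F : Finset (V → V) := Finset.univ.filter fun p => IsParentMap c₀ τ p with hF
  have hmemF : ∀ p, p ∈ F ↔ IsParentMap c₀ τ p := fun p => by simp [hF]
  set X : ℤ → Finset V := fun i => Finset.univ.filter fun v => outType (τ v) = some (i, upStep m)
    with hX
  have hmemX : ∀ i v, v ∈ X i ↔ outType (τ v) = some (i, upStep m) := fun i v => by simp [hX]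
  -- An element of `U` chooses one representative in each class `(i;1)`. The number of rooted
  -- functions does not depend on this choice, so it can be summed over `U` and the two sums
  -- exchanged.
  set U := Fintype.piFinset fun i : ↥(Finset.Icc 1 r) => X i with hU
  have hA : Nat.card {p : V → V // IsParentMap c₀ τ p ∧ IsRootedType τ p} =
      (F.filter fun p => IsRootedAt p ρ).card := by
    rw [Nat.card_eq_fintype_card, Fintype.card_subtype, hF, Finset.filter_filter]
    simp only [isRootedType_iff hρ]
  have hFc : Nat.card {p : V → V // IsParentMap c₀ τ p} = F.card := by
    rw [Nat.card_eq_fintype_card, Fintype.card_subtype]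
  have key : ∀ u ∈ U, (F.filter fun p => IsRootedAt p ρ).card =
      (F.filter fun p => ∀ i : ↥(Finset.Icc 1 r), outType (τ (p (u i))) = chainType m i).card := by
    intro u hu
    rw [hU, Fintype.mem_piFinset] at hu
    simp only [hmemX] at hu
    -- The choice `u` is imposed on the classes `(i;1)`; the other representatives are arbitrary,
    -- with `ρ` as a default for empty classes.
    let rep : Option (ℤ × ↥(stepSet m)) → V := fun o =>
      if h : ∃ i : ↥(Finset.Icc 1 r), o = some ((i : ℤ), upStep m) then u h.choose
      else if h : ∃ v, outType (τ v) = o then h.choose else ρ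
    have hrep : ∀ v, outType (τ (rep (outType (τ v)))) = outType (τ v) := by
      intro v
      by_cases h : ∃ i : ↥(Finset.Icc 1 r), outType (τ v) = some ((i : ℤ), upStep m)
      · simp only [rep, dif_pos h]
        rw [hu]; exact h.choose_spec.symm
      · have h' : ∃ w, outType (τ w) = outType (τ v) := ⟨v, rfl⟩
        simp only [rep, dif_neg h, dif_pos h']
        exact h'.choose_spec
    have hrepu : ∀ i : ↥(Finset.Icc 1 r), rep (some ((i : ℤ), upStep m)) = u i := by
      intro i
      have h : ∃ j : ↥(Finset.Icc 1 r), some ((i : ℤ), upStep m) = some ((j : ℤ), upStep m) :=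
        ⟨i, rfl⟩
      simp only [rep, dif_pos h]
      have h1 := (Prod.ext_iff.mp (Option.some.inj h.choose_spec)).1
      exact congrArg u (Subtype.ext h1).symm
    rw [card_isRootedAt_rep (fun v => outType (τ v)) rep hrep ρ]
    · congr 1
      refine Finset.filter_congr fun p hp => ?_
      rw [isRootedAt_rep_iff hρ ((hmemF p).mp hp) hnonneg hr hrep hup]
      constructor
      · intro h i
        rw [← hrepu]; exact h i i.2
      · intro h i hi
        rw [hrepu ⟨i, hi⟩]; exact h ⟨i, hi⟩
    · intro v hv
      rw [(hρ ρ).mp rfl, outType_none, outType_eq_none] at hv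
      exact (hρ v).mpr hv
    · intro p hp
      exact ((hmemF p).mp hp).root ρ ((hρ ρ).mp rfl)
    · intro p hp u v huv
      rw [hmemF] at hp ⊢
      refine hp.comp_perm hρ _ fun w => ?_
      by_cases h1 : w = u
      · rw [h1, Equiv.swap_apply_left, huv]
      by_cases h2 : w = v
      · rw [h2, Equiv.swap_apply_right, huv]
      · rw [Equiv.swap_apply_of_ne_of_ne h1 h2]
  have hUcard : U.card = ∏ i ∈ Finset.Icc 1 r, (X i).card := by
    rw [hU, Fintype.card_piFinset, ← Finset.prod_coe_sort (Finset.Icc 1 r)]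
  rw [← hUcard, hA, hFc, ← smul_eq_mul, ← Finset.sum_const, Finset.sum_congr rfl key]
  simp only [Finset.card_filter]
  rw [Finset.sum_comm]
  have hp : ∀ p ∈ F, (∑ u ∈ U, if (∀ i : ↥(Finset.Icc 1 r),
      outType (τ (p (u i))) = chainType m i) then 1 else 0) =
      ∏ i ∈ Finset.Icc 1 r,
        ∑ w, if outType (τ w) = chainType m i then (typeVector c₀ (τ w)).coord 1 else 0 := by
    intro p hp
    rw [← Finset.card_filter]
    -- For fixed `p` the conditions on the different `u i` are independent, so the good choices form
    -- a product set.
    have h1 : (U.filter fun u => ∀ i : ↥(Finset.Icc 1 r), outType (τ (p (u i))) = chainType m i) =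
        Fintype.piFinset fun i : ↥(Finset.Icc 1 r) =>
          Finset.univ.filter fun v => outType (τ v) = some ((i : ℤ), upStep m) ∧
            outType (τ (p v)) = chainType m i := by
      ext u
      simp only [hU, Finset.mem_filter, Fintype.mem_piFinset, hmemX, Finset.mem_univ, true_and,
        forall_and]
    rw [h1, Fintype.card_piFinset, ← Finset.prod_coe_sort (Finset.Icc 1 r)]
    refine Finset.prod_congr rfl fun i _ => ((hmemF p).mp hp).card_upStep i _ fun w hw => ?_
    by_cases hi : (i : ℤ) = 1
    · rw [chainType, if_pos hi, outType_eq_none] at hw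
      rw [hw, typeLevel_none, hi, sub_self]
    · rw [chainType, if_neg hi] at hw
      obtain ⟨t, ht, h2, -⟩ := outType_eq_some hw
      rw [ht, typeLevel_some, h2]
  rw [Finset.sum_congr rfl hp, Finset.sum_const, smul_eq_mul]

end Chains

/-! ### Counting type assignments and parent functions -/

section Counting

variable {m : ℤ}

/-- The number of assignments of types. -/
theorem TypeDistribution.card_isTypeAssignment (n : TypeDistribution m) :
    Nat.card {τ : Fin n.size → Option (VertexType m) // n.IsTypeAssignment τ} *
      n.prod (fun _ k => k !) = n.size ! := by
  classical
  set c : Option (VertexType m) → ℕ := fun o => o.elim 1 n with hc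
  have hone : ∀ τ : Fin n.size → Option (VertexType m), n.IsTypeAssignment τ →
      Nat.card {v // τ v = none} = 1 := by
    intro τ h
    obtain ⟨ρ, hρ⟩ := h.exists_root
    rw [Nat.card_congr (Equiv.subtypeEquivRight fun v => (hρ v).symm)]
    simp
  -- With a single colour this is a multinomial coefficient, the root type `none` having
  -- multiplicity one.
  have h := card_prescribed_fibres (α := Fin n.size) (β := Option (VertexType m)) (K := Unit)
    (Finset.insertNone n.support) c ?_ (fun _ => ()) (fun _ => ()) {()} (by simp) ?_
  · rw [Finset.prod_insertNone] at h
    rw [Finset.prod_singleton] at h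
    have e2 : Nat.card {f : Fin n.size → Option (VertexType m) //
        (∀ b, Nat.card {a // f a = b} = c b) ∧ (fun _ => ()) ∘ f = fun _ => ()} =
        Nat.card {τ : Fin n.size → Option (VertexType m) // n.IsTypeAssignment τ} := by
      refine Nat.card_congr (Equiv.subtypeEquivRight fun τ => ⟨fun h t => h.1 (some t), fun h => ?_⟩)
      refine ⟨?_, rfl⟩
      rintro (_ | t)
      · exact hone τ h
      · exact h t
    rw [e2] at h
    simpa [hc, Finsupp.prod] using h
  · rintro (_ | t) ht
    · simp at ht
    · simpa [hc] using ht
  · intro k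
    simp only [Finset.filter_true, hc, Finset.sum_insertNone, Option.elim_none, Option.elim_some]
    rw [Nat.card_congr (Equiv.subtypeUnivEquiv (p := fun _ : Fin n.size => True)
      fun _ => trivial), Nat.card_eq_fintype_card,
      Fintype.card_fin]
    rfl

open Classical in
theorem TypeDistribution.IsTypeAssignment.card_outType {n : TypeDistribution m}
    {τ : Fin n.size → Option (VertexType m)} (h : n.IsTypeAssignment τ) (i : ℤ)
    (s : ↥(stepSet m)) :
    (Finset.univ.filter fun v => outType (τ v) = some (i, s)).card = n.outCount i s := by
  rw [Finset.card_filter, h.sum_eq fun o => if outType o = some (i, s) then 1 else 0]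
  simp only [outType_none, reduceCtorEq, if_false, zero_add, TypeDistribution.outCount]
  refine Finset.sum_congr rfl fun t _ => ?_
  simp only [outType_some, Option.some.injEq, Prod.mk.injEq, ← Subtype.ext_iff, mul_ite, mul_one,
    mul_zero]

open Classical in
/-- The number of parent functions compatible with a given assignment of types. -/
theorem TypeDistribution.IsTypeAssignment.card_isParentMap {n : TypeDistribution m} {c₀ : ℕ}
    {τ : Fin n.size → Option (VertexType m)} (h : n.IsTypeAssignment τ) (hn : n.Compatible c₀)
    (L : Finset ℤ) (hL : ∀ v, typeLevel (τ v) ∈ L) :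
    Nat.card {p : Fin n.size → Fin n.size // IsParentMap c₀ τ p} *
      ∏ s : ↥(stepSet m), ∏ v, ((typeVector c₀ (τ v)).coord s)! =
    ∏ s : ↥(stepSet m), ∏ i ∈ L, (n.outCount i s)! := by
  obtain ⟨ρ, hρ⟩ := h.exists_root
  -- A parent function is read as `v ↦ (increment of v, p v)`. The fibre over `(s, w)` has the
  -- prescribed size `c^s` of `w`, the root goes to `(none, ρ)`, and the colours are the out-types.
  set c : Option ↥(stepSet m) × Fin n.size → ℕ := fun b =>
    b.1.elim (if b.2 = ρ then 1 else 0) fun s => (typeVector c₀ (τ b.2)).coord s with hc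
  set γ : Option ↥(stepSet m) × Fin n.size → Option (ℤ × ↥(stepSet m)) := fun b =>
    b.1.map fun s : ↥(stepSet m) => (typeLevel (τ b.2) + (s : ℤ), s) with hγ
  have hfib : ∀ i (s : ↥(stepSet m)),
      Nat.card {v // outType (τ v) = some (i, s)} = n.outCount i s := by
    intro i s
    rw [Nat.card_eq_fintype_card, Fintype.card_subtype, h.card_outType]
  have hnone : Nat.card {v // outType (τ v) = none} = 1 := by
    simp only [outType_eq_none, ← hρ]; simp
  have key := card_prescribed_fibres (Finset.univ) c (by simp) γ (fun v => outType (τ v))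
    (Finset.insertNone (L ×ˢ Finset.univ)) ?_ ?_
  · rw [Finset.prod_insertNone, Finset.prod_product_right, hnone] at key
    simp only [hfib, Nat.factorial_one, one_mul] at key
    rw [← key]
    congr 1
    · refine Nat.card_congr
        { toFun := fun p => ⟨fun v => ((τ v).map fun t => t.2.1, p.1 v), ?_, ?_⟩
          invFun := fun f => ⟨fun v => (f.1 v).2, ?_⟩
          left_inv := fun p => rfl
          right_inv := ?_ }
      · rintro ⟨_ | s, w⟩
        · have h1 : ∀ v, ((τ v).map (fun t => t.2.1), p.1 v) = (none, w) ↔ v = ρ ∧ ρ = w := by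
            intro v
            rw [Prod.mk.injEq, Option.map_eq_none_iff, ← hρ]
            refine and_congr_right fun h => ?_
            rw [h, p.2.root ρ ((hρ ρ).mp rfl)]
          simp only [h1, hc, Option.elim_none]
          by_cases hw : w = ρ
          · subst hw; simp
          · simp [hw, Ne.symm hw]
        · simp only [hc, Option.elim_some, Prod.mk.injEq]
          exact p.2.children w s
      · funext v
        rcases hv : τ v with _ | t
        · simp [hγ, hv]
        · simp [hγ, hv, p.2.level v t hv]
      · obtain ⟨f, hf1, hf2⟩ := f
        have hfst : ∀ v, (f v).1 = (τ v).map fun t => t.2.1 := by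
          intro v
          have h1 := congrArg (Option.map Prod.snd) (congrFun hf2 v)
          simp only [hγ, Function.comp_apply, Option.map_map, outType, Function.comp_def] at h1
          rw [← h1]; simp
        refine ⟨fun v hv => ?_, fun v t hv => ?_, fun w s => ?_⟩
        · have h1 := hf1 (none, (f v).2)
          have h2 : (f v).1 = none := by rw [hfst, hv]; rfl
          have h3 : 0 < Nat.card {a // f a = (none, (f v).2)} := by
            have : Nonempty {a // f a = (none, (f v).2)} := ⟨⟨v, Prod.ext h2 rfl⟩⟩
            exact Nat.card_pos
          rw [h1] at h3
          simp only [hc, Option.elim_none] at h3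
          rw [(hρ v).mpr hv] at h3 ⊢
          by_contra h4
          rw [if_neg h4] at h3
          exact h3.false
        · have h1 := congrFun hf2 v
          simp only [hγ, Function.comp_apply, hfst, hv, Option.map_some, outType_some,
            Option.some.injEq, Prod.mk.injEq, and_true] at h1
          linarith
        · have h1 := hf1 (some s, w)
          simp only [hc, Option.elim_some] at h1
          rw [← h1]
          refine Nat.card_congr (Equiv.subtypeEquivRight fun v => ?_)
          rw [← hfst, Prod.ext_iff]
      · rintro ⟨f, hf1, hf2⟩
        refine Subtype.ext (funext fun v => Prod.ext ?_ rfl)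
        have h1 := congrArg (Option.map Prod.snd) (congrFun hf2 v)
        simp only [hγ, Function.comp_apply, Option.map_map, outType, Function.comp_def] at h1
        simp only
        rw [← h1]; simp
    · rw [← Finset.univ_product_univ, Finset.prod_product, Fintype.prod_option]
      have h1 : ∏ w : Fin n.size, (c (none, w))! = 1 := by
        refine Finset.prod_eq_one fun w _ => ?_
        simp only [hc, Option.elim_none]
        split_ifs <;> rfl
      rw [h1, one_mul]
      rfl
  · intro v
    rcases hv : τ v with _ | t
    · simp
    · have := hL v
      rw [hv, typeLevel_some] at this
      simpa using this
  · rintro (_ | ⟨i, s⟩)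
    · rw [hnone, Finset.sum_filter, ← Finset.univ_product_univ, Finset.sum_product,
        Fintype.sum_option]
      simp [hγ, hc]
    -- For the colour `(i, s)`, the required equality of sizes is the compatibility condition.
    · rw [hfib, ← hn i s s.2, Finset.sum_filter, ← Finset.univ_product_univ, Finset.sum_product,
        Fintype.sum_option, Finset.sum_eq_single s]
      · simp only [hγ, hc, Option.map_none, Option.map_some, reduceCtorEq, if_false,
          Finset.sum_const_zero, zero_add, Option.some.injEq, Prod.mk.injEq, and_true,
          Option.elim_some]
        rw [h.sum_eq fun o => if typeLevel o + s = i then (typeVector c₀ o).coord s else 0]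
        congr 1
        · simp [eq_comm]
        · refine Finset.sum_congr rfl fun t _ => ?_
          by_cases hi : t.1 + (s : ℤ) = i
          · have hi' : t.1 = i - s := by omega
            simp [hi', mul_comm]
          · have hi' : ¬ t.1 = i - s := by omega
            simp [hi, hi']
      · intro s' _ hs'
        refine Finset.sum_eq_zero fun w _ => ?_
        simp [hγ, hs']
      · simp

theorem finprod_pow_sum {ι : Type*} (f : ι →₀ ℕ) (ψ : ι → ℕ) (g : ℕ → ℚ) (B : Finset ℕ)
    (hB : ∀ x ∈ f.support, ψ x ∈ B) :
    ∏ b ∈ B, g b ^ (f.sum fun x k => if ψ x = b then k else 0) = f.prod fun x k => g (ψ x) ^ k := by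
  simp only [Finsupp.sum, Finsupp.prod, ← Finset.prod_pow_eq_pow_sum]
  rw [Finset.prod_comm]
  refine Finset.prod_congr rfl fun x hx => ?_
  simp only [pow_ite, pow_zero]
  rw [Finset.prod_ite_eq, if_pos (hB x hx)]

theorem TypeDistribution.finprod_factorial_childCount (n : TypeDistribution m) (c₀ : ℕ) (s : ℤ)
    (hs : s ∈ Finset.Icc m 1) :
    ∏ᶠ b : ℕ, (b ! : ℚ) ^ n.childCount c₀ s b =
      (((rootVector m c₀).coord s)! : ℚ) * n.prod fun t k => ((t.2.2.coord s)! : ℚ) ^ k := by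
  classical
  set B : Finset ℕ := insert c₀ (n.support.image fun t => t.2.2.coord s) with hB
  have h1 : Function.mulSupport (fun b : ℕ => (b ! : ℚ) ^ n.childCount c₀ s b) ⊆ B := by
    intro b hb
    by_contra hbB
    refine hb ?_
    have hbc : b ≠ c₀ := fun h => hbB (by simp [hB, h])
    have hbt : ∀ t ∈ n.support, t.2.2.coord s ≠ b := fun t ht h =>
      hbB (by
        rw [hB, Finset.mem_coe]
        exact Finset.mem_insert_of_mem (Finset.mem_image.mpr ⟨t, ht, h⟩))
    have : n.childCount c₀ s b = 0 := by
      rw [childCount, if_neg (by tauto), add_zero]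
      exact Finset.sum_eq_zero fun t ht => if_neg (hbt t ht)
    simp [this]
  rw [finprod_eq_prod_of_mulSupport_subset _ h1]
  simp only [childCount, pow_add, Finset.prod_mul_distrib]
  rw [finprod_pow_sum n (fun t => t.2.2.coord s) (fun b => (b ! : ℚ)) B
    fun t ht => Finset.mem_insert_of_mem (Finset.mem_image_of_mem _ ht), mul_comm]
  congr 1
  rw [ChildVector.coord_of_mem _ hs]
  by_cases h : s = 1
  · simp only [h, rootVector, true_and, if_true, pow_ite, pow_one, pow_zero]
    rw [Finset.prod_ite_eq', if_pos (by simp [hB])]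
  · simp [h, rootVector]

/-- Grouping the vertices of out-type `(i;1)` by their value of `c^1`; the index `b = 0` contributes
nothing. -/
theorem TypeDistribution.finsum_upCount (n : TypeDistribution m) (i : ℤ) :
    ∑ᶠ b : ℕ, (b : ℚ) * (n.upCount i b : ℚ) =
      ((n.sum fun t k => k * if outType (some t) = some (i, upStep m) then t.2.2.coord 1 else 0 :
        ℕ) : ℚ) := by
  classical
  set B : Finset ℕ := n.support.image fun t => t.2.2.coord 1 with hB
  have h1 : Function.support (fun b : ℕ => (b : ℚ) * (n.upCount i b : ℚ)) ⊆ B := by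
    intro b hb
    by_contra hbB
    refine hb ?_
    have : n.upCount i b = 0 := by
      refine Finset.sum_eq_zero fun t ht => if_neg fun h => ?_
      exact hbB (Finset.mem_coe.mpr (Finset.mem_image.mpr ⟨t, ht, h.2.2⟩))
    simp [this]
  rw [finsum_eq_sum_of_support_subset _ h1]
  simp only [upCount, Finsupp.sum]
  push_cast
  simp only [Finset.mul_sum]
  rw [Finset.sum_comm]
  refine Finset.sum_congr rfl fun t ht => ?_
  have h2 : outType (some t) = some (i, upStep m) ↔ t.1 = i ∧ (t.2.1 : ℤ) = 1 := by
    rw [outType_some, Option.some.injEq, Prod.mk.injEq, Subtype.ext_iff]; rfl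
  rw [Finset.sum_eq_single (t.2.2.coord 1)]
  · by_cases h3 : t.1 = i ∧ (t.2.1 : ℤ) = 1
    · rw [if_pos ⟨h3.1, h3.2, rfl⟩, if_pos (h2.mpr h3), mul_comm]
    · rw [if_neg (by tauto), if_neg (by tauto)]; simp
  · intro b _ hb
    rw [if_neg fun h => hb h.2.2.symm, mul_zero]
  · intro h3
    exact absurd (Finset.mem_image_of_mem _ ht) h3

end Counting

/-! ### Assembling the product formula -/

section ProductFormula

namespace TypeDistribution

variable {m : ℤ} {n : TypeDistribution m} {c₀ : ℕ} {r : ℤ}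

theorem mem_Icc_of_pos (hneg : ∀ (i : ℤ) (s : ↥(stepSet m)) (c : ChildVector m),
      i < 0 → n (i, s, c) = 0) (hr : IsGreatest {i : ℤ | 0 < n.levelCount i} r)
    {t : VertexType m} (ht : 0 < n t) : t.1 ∈ Finset.Icc 0 r := by
  refine Finset.mem_Icc.mpr ⟨?_, hr.2 ?_⟩
  · by_contra h
    exact ht.ne' (hneg t.1 t.2.1 t.2.2 (not_le.mp h))
  · rw [Set.mem_ofPred_eq]
    refine lt_of_lt_of_le ht (le_trans ?_ (Nat.le_add_left _ _))
    have h := Finset.single_le_sum (f := fun x => if x.1 = t.1 then n x else 0)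
      (fun x _ => Nat.zero_le _) (Finsupp.mem_support_iff.mpr ht.ne')
    simpa [Finsupp.sum] using h

theorem IsTypeAssignment.typeLevel_mem {τ : Fin n.size → Option (VertexType m)}
    (h : n.IsTypeAssignment τ) (hneg : ∀ (i : ℤ) (s : ↥(stepSet m)) (c : ChildVector m),
      i < 0 → n (i, s, c) = 0) (hr : IsGreatest {i : ℤ | 0 < n.levelCount i} r)
    (v : Fin n.size) : typeLevel (τ v) ∈ Finset.Icc 0 r := by
  rcases hv : τ v with _ | t
  · refine Finset.mem_Icc.mpr ⟨le_rfl, hr.2 ?_⟩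
    rw [Set.mem_ofPred_eq, typeLevel_none, levelCount, if_pos rfl]
    omega
  · exact mem_Icc_of_pos hneg hr (h.pos hv)

theorem exists_of_outCount_ne_zero {i s : ℤ} (h : n.outCount i s ≠ 0) :
    ∃ t : VertexType m, 0 < n t ∧ t.1 = i ∧ (t.2.1 : ℤ) = s := by
  obtain ⟨t, ht, h1⟩ := Finset.exists_ne_zero_of_sum_ne_zero h
  refine ⟨t, Nat.pos_of_ne_zero (Finsupp.mem_support_iff.mp ht), ?_⟩
  by_contra h2
  exact h1 (if_neg h2)

/-- A non-root vertex at abscissa `1` settles the claim. Otherwise compatibility provides a non-root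
type for its parent: an increment `1` from a nonnegative level forces level at least `1`, and a
negative increment puts the parent at a positive level. -/
theorem one_le_of_isGreatest (hn : n ≠ 0)
    (hneg : ∀ (i : ℤ) (s : ↥(stepSet m)) (c : ChildVector m), i < 0 → n (i, s, c) = 0)
    (hcompat : n.Compatible c₀) (hr : IsGreatest {i : ℤ | 0 < n.levelCount i} r) : 1 ≤ r := by
  obtain ⟨t, ht⟩ := Finsupp.ne_iff.mp hn
  have ht' : 0 < n t := Nat.pos_of_ne_zero ht
  have h1 := Finset.mem_Icc.mp (mem_Icc_of_pos hneg hr ht')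
  have h2 : 0 < n.outCount t.1 t.2.1 := by
    have h := Finset.single_le_sum
      (f := fun x => if x.1 = t.1 ∧ (x.2.1 : ℤ) = t.2.1 then n x else 0)
      (fun x _ => Nat.zero_le _) (Finsupp.mem_support_iff.mpr ht)
    simp only [and_self, if_true] at h
    exact lt_of_lt_of_le ht' h
  rw [← hcompat t.1 t.2.1 t.2.1.2] at h2
  by_cases h3 : t.1 = 1
  · omega
  have h4 : (if t.1 = (t.2.1 : ℤ) then (rootVector m c₀).coord t.2.1 else 0) = 0 := by
    split_ifs with h5
    · have h6 : (t.2.1 : ℤ) ≠ 1 := fun h => h3 (h5.trans h)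
      rw [ChildVector.coord]
      split_ifs
      · exact if_neg h6
      · rfl
    · rfl
  rw [h4, zero_add] at h2
  obtain ⟨x, hx, h5⟩ := Finset.exists_ne_zero_of_sum_ne_zero h2.ne'
  have h6 : x.1 = t.1 - t.2.1 := by
    by_contra h; exact h5 (if_neg h)
  have h7 := Finset.mem_Icc.mp
    (mem_Icc_of_pos hneg hr (Nat.pos_of_ne_zero (Finsupp.mem_support_iff.mp hx)))
  rcases eq_one_or_neg t.2.1.2 with h8 | h8 <;> omega

/-- The number of pairs of a vertex of out-type `(i; 1)` and a child at abscissa `i + 1`. -/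
noncomputable def upEdges (n : TypeDistribution m) (i : ℤ) : ℕ :=
  n.sum fun t k => k * if outType (some t) = some (i, upStep m) then t.2.2.coord 1 else 0

-- The factor `i = 1` comes from the root and equals `c₀`; for `i ≥ 2` the factor is `upEdges (i -
-- 1)`, so the remaining product is reindexed over `1, …, r - 1`.
open Classical in
theorem IsTypeAssignment.prod_chain (hm : m ≤ 1) {τ : Fin n.size → Option (VertexType m)}
    (h : n.IsTypeAssignment τ) (hr : 1 ≤ r) :
    ∏ i ∈ Finset.Icc 1 r,
      (∑ w, if outType (τ w) = chainType m i then (typeVector c₀ (τ w)).coord 1 else 0) =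
    c₀ * ∏ i ∈ Finset.Icc 1 (r - 1), n.upEdges i := by
  have hsum : ∀ i : ℤ,
      (∑ w, if outType (τ w) = chainType m i then (typeVector c₀ (τ w)).coord 1 else 0) =
      if i = 1 then c₀ else n.upEdges (i - 1) := by
    intro i
    rw [h.sum_eq fun o => if outType o = chainType m i then (typeVector c₀ o).coord 1 else 0]
    by_cases hi : i = 1
    · have h1 : (rootVector m c₀).coord 1 = c₀ := by
        rw [ChildVector.coord_of_mem _ (Finset.mem_Icc.mpr ⟨hm, le_rfl⟩)]
        exact if_pos rfl
      simp [chainType, hi, h1]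
    · simp only [chainType, hi, if_false, outType_none, reduceCtorEq, zero_add]
      exact Finset.sum_congr rfl fun t _ => by simp only [typeVector_some]
  simp only [hsum]
  rw [← Finset.mul_prod_erase _ _ (Finset.mem_Icc.mpr ⟨le_rfl, hr⟩), if_pos rfl]
  congr 1
  refine Finset.prod_bij' (fun i _ => i - 1) (fun i _ => i + 1) ?_ ?_ ?_ ?_ ?_
  · intro i hi
    simp only [Finset.mem_erase, Finset.mem_Icc] at hi ⊢
    omega
  · intro i hi
    simp only [Finset.mem_erase, Finset.mem_Icc] at hi ⊢
    omega
  · intro i _; ring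
  · intro i _; ring
  · intro i hi
    rw [if_neg (Finset.mem_erase.mp hi).1]

/-- The division-free form of the formula: every type assignment contributes the same number of
rooted parent functions. -/
theorem numTrees_mul (hm : m ≤ 1) (hn : n ≠ 0)
    (hneg : ∀ (i : ℤ) (s : ↥(stepSet m)) (c : ChildVector m), i < 0 → n (i, s, c) = 0)
    (hzero : ∀ (i : ℤ) (s : ↥(stepSet m)) (c : ChildVector m), 0 < c.coord 0 → n (i, s, c) = 0)
    (hcompat : n.Compatible c₀) (hr : IsGreatest {i : ℤ | 0 < n.levelCount i} r)
    (hup : ∀ i ∈ Finset.Icc 1 r, 0 < n.outCount i 1) :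
    (∏ i ∈ Finset.Icc 1 r, n.outCount i 1) * n.numTrees c₀ *
        (∏ s : ↥(stepSet m),
          (((rootVector m c₀).coord s)! * n.prod fun t k => (t.2.2.coord s)! ^ k)) *
        n.prod (fun _ k => k !) =
      n.size ! * (∏ s : ↥(stepSet m), ∏ i ∈ Finset.Icc 0 r, (n.outCount i s)!) *
        (c₀ * ∏ i ∈ Finset.Icc 1 (r - 1), n.upEdges i) := by
  classical
  have hr1 := one_le_of_isGreatest hn hneg hcompat hr
  set Q := {τ : Fin n.size → Option (VertexType m) // n.IsTypeAssignment τ} with hQ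
  -- There may be infinitely many types, so finiteness is read off from the counting identity: an
  -- infinite `Q` would have `Nat.card` equal to `0`, but `n.size !` is nonzero.
  have hfin : Finite Q := by
    refine Nat.finite_of_card_ne_zero fun h => ?_
    have h1 := n.card_isTypeAssignment
    rw [h, zero_mul] at h1
    exact (Nat.factorial_pos n.size).ne h1
  have := Fintype.ofFinite Q
  have e : {x : (Fin n.size → Option (VertexType m)) × (Fin n.size → Fin n.size) //
      n.IsTypeAssignment x.1 ∧ IsParentMap c₀ x.1 x.2 ∧ IsRootedType x.1 x.2} ≃
      Σ τ : Q, {p : Fin n.size → Fin n.size // IsParentMap c₀ τ.1 p ∧ IsRootedType τ.1 p} :=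
    { toFun := fun x => ⟨⟨x.1.1, x.2.1⟩, ⟨x.1.2, x.2.2⟩⟩
      invFun := fun y => ⟨(y.1.1, y.2.1), ⟨y.1.2, y.2.2⟩⟩
      left_inv := fun x => rfl
      right_inv := fun y => rfl }
  have key : ∀ τ : Q, (∏ i ∈ Finset.Icc 1 r, n.outCount i 1) *
      Nat.card {p : Fin n.size → Fin n.size // IsParentMap c₀ τ.1 p ∧ IsRootedType τ.1 p} *
      (∏ s : ↥(stepSet m),
          (((rootVector m c₀).coord s)! * n.prod fun t k => (t.2.2.coord s)! ^ k)) =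
      (∏ s : ↥(stepSet m), ∏ i ∈ Finset.Icc 0 r, (n.outCount i s)!) *
        (c₀ * ∏ i ∈ Finset.Icc 1 (r - 1), n.upEdges i) := by
    rintro ⟨τ, h⟩
    obtain ⟨ρ, hρ⟩ := h.exists_root
    have hlev := h.typeLevel_mem hneg hr
    have hcard : ∀ i : ℤ,
        (Finset.univ.filter fun v => outType (τ v) = some (i, upStep m)).card = n.outCount i 1 :=
      fun i => h.card_outType i (upStep m)
    have h1 := card_rooted_mul_prod (r := r) c₀ hρ (fun v => (Finset.mem_Icc.mp (hlev v)).1)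
      (fun v => (Finset.mem_Icc.mp (hlev v)).2) fun i hi => by
        have h2 := hup i hi
        rw [← hcard, Finset.card_pos] at h2
        obtain ⟨v, hv⟩ := h2
        exact ⟨v, (Finset.mem_filter.mp hv).2⟩
    have h3 := h.card_isParentMap hcompat (Finset.Icc 0 r) hlev
    simp only [hcard] at h1
    rw [h.prod_chain hm hr1] at h1
    have h4 : ∀ s : ↥(stepSet m), ∏ v, ((typeVector c₀ (τ v)).coord s)! =
        ((rootVector m c₀).coord s)! * n.prod fun t k => (t.2.2.coord s)! ^ k :=
      fun s => h.prod_eq fun o => ((typeVector c₀ o).coord s)!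
    simp only [h4] at h3
    rw [h1, ← h3]
    ring
  rw [numTrees_eq hm c₀ n hzero, Nat.card_congr e, Nat.card_sigma, Finset.mul_sum, Finset.sum_mul,
    Finset.sum_congr rfl fun τ _ => key τ, Finset.sum_const, Finset.card_univ, smul_eq_mul,
    ← n.card_isTypeAssignment, ← Nat.card_eq_fintype_card]
  ring

/-- A path to the root from a vertex at the maximal abscissa `r` must meet every class `(i;1)` with
`1 ≤ i ≤ r`, so none of them can be empty. -/
theorem numTrees_eq_zero (hm : m ≤ 1)
    (hzero : ∀ (i : ℤ) (s : ↥(stepSet m)) (c : ChildVector m), 0 < c.coord 0 → n (i, s, c) = 0)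
    (hr : IsGreatest {i : ℤ | 0 < n.levelCount i} r)
    (h : ∃ i ∈ Finset.Icc 1 r, n.outCount i 1 = 0) : n.numTrees c₀ = 0 := by
  classical
  obtain ⟨i, hi, h0⟩ := h
  rw [Finset.mem_Icc] at hi
  rw [numTrees_eq hm c₀ n hzero, Nat.card_eq_zero]
  refine Or.inl ⟨?_⟩
  rintro ⟨⟨τ, p⟩, h1, h2, h3⟩
  simp only at h1 h2 h3
  have h4 : 0 < n.levelCount r := hr.1
  rw [levelCount, if_neg (by omega), zero_add] at h4
  obtain ⟨t, ht, h5⟩ := Finset.exists_ne_zero_of_sum_ne_zero h4.ne'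
  have h6 : t.1 = r := by
    by_contra h; exact h5 (if_neg h)
  have h7 : Nat.card {v // τ v = some t} ≠ 0 := by
    rw [h1 t]; exact Finsupp.mem_support_iff.mp ht
  obtain ⟨⟨v, hv⟩, -⟩ := Nat.card_ne_zero.mp h7
  obtain ⟨k, hk⟩ := h3 v
  obtain ⟨j, hj⟩ := exists_outType_of_path h2.level hi.1 (z := v)
    (by rw [hv, typeLevel_some]; omega) hk
  have h8 := h1.card_outType i (upStep m)
  rw [show ((upStep m : ↥(stepSet m)) : ℤ) = 1 from rfl, h0, Finset.card_eq_zero,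
    Finset.filter_eq_empty_iff] at h8
  exact h8 (Finset.mem_univ _) hj

end TypeDistribution

end ProductFormula

theorem mainTheorem8 (m : ℤ) (hm : m ≤ 1) (c₀ : ℕ) (n : TypeDistribution m)
    -- the family is nonzero: there is at least one non-root vertex
    (hn : n ≠ 0)
    (hneg : ∀ (i : ℤ) (s : ↥(stepSet m)) (c : ChildVector m), i < 0 → n (i, s, c) = 0)
    (hzero : ∀ (i : ℤ) (s : ↥(stepSet m)) (c : ChildVector m),
      0 < c.coord 0 → n (i, s, c) = 0)
    (hcompat : n.Compatible c₀)
    -- `r` is the maximal abscissa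
    (r : ℤ) (hr : IsGreatest {i : ℤ | 0 < n.levelCount i} r) :
    -- the product formula, when the denominator does not vanish
    ((∀ i ∈ Finset.Icc 1 r, 0 < n.outCount i 1) →
      (n.numTrees c₀ : ℚ) =
        ((c₀ : ℚ) * (n.size ! : ℚ) *
            ∏ s ∈ stepSet m, ∏ᶠ i : ℤ, ((n.outCount i s)! : ℚ)) /
          ((n.prod fun _ k => (k ! : ℚ)) *
            (∏ i ∈ Finset.Icc 1 r, (n.outCount i 1 : ℚ)) *
            ∏ s ∈ stepSet m, ∏ᶠ b : ℕ, (b ! : ℚ) ^ n.childCount c₀ s b) *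
          ∏ i ∈ Finset.Icc 1 (r - 1), ∑ᶠ b : ℕ, (b : ℚ) * (n.upCount i b : ℚ)) ∧
    -- the degenerate case, where there is no such tree
    ((∃ i ∈ Finset.Icc 1 r, n.outCount i 1 = 0) → n.numTrees c₀ = 0) := by
  refine ⟨fun hup => ?_, TypeDistribution.numTrees_eq_zero hm hzero hr⟩
  have key := congrArg (Nat.cast : ℕ → ℚ)
    (TypeDistribution.numTrees_mul hm hn hneg hzero hcompat hr hup)
  -- Outside `0, …, r` the factor is `0! = 1`, so the product has finite support.
  have h1 : ∀ s : ℤ, ∏ᶠ i : ℤ, ((n.outCount i s)! : ℚ) =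
      ∏ i ∈ Finset.Icc 0 r, ((n.outCount i s)! : ℚ) := by
    intro s
    refine finprod_eq_prod_of_mulSupport_subset _ fun i hi => ?_
    have h2 : n.outCount i s ≠ 0 := by
      intro h
      refine hi ?_
      simp [h]
    obtain ⟨t, ht, rfl, -⟩ := TypeDistribution.exists_of_outCount_ne_zero h2
    exact TypeDistribution.mem_Icc_of_pos hneg hr ht
  have h2 : ∏ s ∈ stepSet m, ∏ᶠ b : ℕ, (b ! : ℚ) ^ n.childCount c₀ s b =
      ∏ s : ↥(stepSet m), ((((rootVector m c₀).coord s)! : ℚ) *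
        n.prod fun t k => ((t.2.2.coord s)! : ℚ) ^ k) := by
    rw [← Finset.prod_coe_sort]
    exact Finset.prod_congr rfl fun s _ =>
      n.finprod_factorial_childCount c₀ s (stepSet_subset hm s.2)
  have h3 : ∏ i ∈ Finset.Icc 1 (r - 1), ∑ᶠ b : ℕ, (b : ℚ) * (n.upCount i b : ℚ) =
      ∏ i ∈ Finset.Icc 1 (r - 1), (n.upEdges i : ℚ) :=
    Finset.prod_congr rfl fun i _ => n.finsum_upCount i
  have p1 : (n.prod fun _ k => (k ! : ℚ)) ≠ 0 :=
    Finset.prod_ne_zero_iff.mpr fun t _ => Nat.cast_ne_zero.mpr (Nat.factorial_ne_zero _)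
  have p2 : (∏ i ∈ Finset.Icc 1 r, (n.outCount i 1 : ℚ)) ≠ 0 :=
    Finset.prod_ne_zero_iff.mpr fun i hi => Nat.cast_ne_zero.mpr (hup i hi).ne'
  have p3 : ∏ s : ↥(stepSet m), ((((rootVector m c₀).coord s)! : ℚ) *
        n.prod fun t k => ((t.2.2.coord s)! : ℚ) ^ k) ≠ 0 :=
    Finset.prod_ne_zero_iff.mpr fun s _ => mul_ne_zero
      (Nat.cast_ne_zero.mpr (Nat.factorial_ne_zero _))
      (Finset.prod_ne_zero_iff.mpr fun t _ =>
        pow_ne_zero _ (Nat.cast_ne_zero.mpr (Nat.factorial_ne_zero _)))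
  simp only [h1]
  rw [h2, h3, ← Finset.prod_coe_sort (stepSet m), div_mul_eq_mul_div,
    eq_div_iff (mul_ne_zero (mul_ne_zero p1 p2) p3)]
  simp only [Finsupp.prod] at key ⊢
  push_cast at key
  linear_combination key
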